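/- Let $q=p^{2f}$ be an even power of an odd prime $p$ ($f\ge 1$), let $\sigma$ be the unique involution in $\mathrm{Aut}(\mathbb F_q)$, and let $\mathrm M(q)$ be the group of permutations of the projective line $\mathrm{PG}(1,q)=\mathbb F_q\cup\{\infty\}$ consisting of the maps $x\mapsto\frac{ax+b}{cx+d}$ with $ad-bc$ a nonzero square in $\mathbb F_q$ and the maps $x\mapsto\frac{ax^\sigma+b}{cx^\sigma+d}$ with $ad-bc$ a non-square in $\mathbb F_q$. Let $\Omega$ be the set of $2$-element subsets of $\mathrm{PG}(1,q)$. Let $\mathscr O=\{(\xi^2:\xi:1)\mid \xi\in\mathbb F_q\}\cup\{(1:0:0)\}$ be the standard conic in $\mathrm{PG}(2,q)$ and let $\mathcal L_+$ be the set of hyperbolic lines, i.e. the lines of $\mathrm{PG}(2,q)$ that meet $\mathscr O$ in exactly two points. Let $\mathrm M(q)$ act on $\mathcal L_+$ through the embedding $\rho$ of $\mathrm P\Gamma\mathrm L(2,q)$ into $\mathrm P\Gamma\mathrm L(3,q)$ that sends the class of $(A,\tau)$, where $A=\begin{pmatrix}a&b\\c&d\end{pmatrix}$, to the class of the semilinear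 map $v\mapsto \begin{pmatrix}a^2&2ab&b^2\\ac&ad+bc&bd\\c^2&2cd&d^2\end{pmatrix}v^\tau$. For $X=\mathcal L_+$, and likewise for $X=\Omega$, let $\mathfrak X(\mathrm M(q),X)$ denote the set of orbits of $\mathrm M(q)$ in its diagonal action on $X\times X$. Then: (i) if $q>9$, then $\mathfrak X(\mathrm M(q),X)$ is a non-symmetric association scheme with $(3q+5)/8$ classes (that is, with $(3q+5)/8$ relations besides the diagonal); (ii) if $q=9$, then $\mathfrak X(\mathrm M(9),X)$ is a symmetric $P$-polynomial association scheme; that is, its relations are symmetric and can be ordered as $R_0,R_1,\dots,R_d$, with $R_0$ the diagonal, such that for each $i$ the adjacency matrix of $R_i$ is a polynomial of degree $i$ in the adjacency matrix of $R_1$. -/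

import Mathlib

open scoped OnePoint Matrix

section Schemes

variable {X : Type*}

/-- A family `𝓡` of binary relations on the finite set `X` (with at least two elements), regarded as
subsets of `X × X`, is an association scheme with `d` classes. The relations `R₀, …, R_d` are the
`d + 1` members of `𝓡`; `R₀` is the diagonal. -/
structure IsAssociationScheme (𝓡 : Set (Set (X × X))) (d : ℕ) : Prop where
  finite : Finite X
  two_le_card : 2 ≤ Nat.card X
  card_relations : 𝓡.ncard = d + 1
  isPartition : Setoid.IsPartition 𝓡
  diagonal_mem : Set.diagonal X ∈ 𝓡
  inverse_mem : ∀ R ∈ 𝓡, Prod.swap ⁻¹' R ∈ 𝓡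
  intersection_number : ∀ R ∈ 𝓡, ∀ S ∈ 𝓡, ∀ T ∈ 𝓡, ∃ n : ℕ, ∀ x y : X, (x, y) ∈ T →
    {z : X | (x, z) ∈ R ∧ (z, y) ∈ S}.ncard = n

/-- Every relation of the family is symmetric. -/
def IsSymmetricFamily (𝓡 : Set (Set (X × X))) : Prop :=
  ∀ R ∈ 𝓡, Prod.swap ⁻¹' R = R

open Classical in
/-- The adjacency matrix of a relation. -/
noncomputable def adjacencyMatrix (R : Set (X × X)) : Matrix X X ℂ :=
  Matrix.of fun x y => if (x, y) ∈ R then 1 else 0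

open Classical in
/-- The family `𝓡` is a symmetric association scheme with `d` classes whose relations can be
ordered as `R₀, R₁, …, R_d`, with `R₀` the diagonal, in such a way that for each `i ≤ d` the
adjacency matrix of `R_i` is a polynomial of degree `i` in the adjacency matrix of `R₁`. -/
def IsPPolynomialScheme (𝓡 : Set (Set (X × X))) (d : ℕ) : Prop :=
  IsAssociationScheme 𝓡 d ∧ IsSymmetricFamily 𝓡 ∧
    ∃ (_ : Fintype X) (R : ℕ → Set (X × X)), Set.BijOn R (Set.Iic d) 𝓡 ∧ R 0 = Set.diagonal X ∧
      ∀ i ≤ d, ∃ v : Polynomial ℂ, v.degree = i ∧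
        adjacencyMatrix (R i) = Polynomial.aeval (adjacencyMatrix (R 1)) v

/-- The orbits of `G` in its diagonal action on `X × X`. -/
def orbitals (G X : Type*) [Group G] [MulAction G X] : Set (Set (X × X)) :=
  Set.range fun p : X × X => MulAction.orbit G p

end Schemes

section Semilinear

variable {F : Type*} [Field F]

instance OnePoint.decEq {α : Type*} [DecidableEq α] : DecidableEq (OnePoint α) :=
  inferInstanceAs (DecidableEq (Option α))

/-- The action of field automorphisms on `GL(n, F)` through the matrix entries. -/
def autGL (n : ℕ) (F : Type*) [Field F] : RingAut F →* MulAut (GL (Fin n) F) where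
  toFun τ := Units.mapEquiv (RingEquiv.mapMatrix τ : Matrix (Fin n) (Fin n) F ≃+* _).toMulEquiv
  map_one' := by ext; rfl
  map_mul' _ _ := by ext; rfl

/-- The group `ΓL(n, F)` of pairs `(A, τ)` with `A` in `GL(n, F)` and `τ` in `Aut F`; the pair
`(A, τ)` stands for the semilinear map `v ↦ A (τ v)`. -/
abbrev GammaL (n : ℕ) (F : Type*) [Field F] : Type _ :=
  GL (Fin n) F ⋊[autGL n F] RingAut F

/-- The semilinear map `v ↦ A (τ v)`. -/
instance GammaL.vectorAction {n : ℕ} : MulAction (GammaL n F) (Fin n → F) where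
  smul g v := (g.left : Matrix (Fin n) (Fin n) F) *ᵥ fun i => g.right (v i)
  one_smul v := by
    change ((1 : GL (Fin n) F) : Matrix (Fin n) (Fin n) F) *ᵥ v = v
    simp
  mul_smul g h v := by
    change ((g.left : Matrix (Fin n) (Fin n) F) * (h.left : Matrix (Fin n) (Fin n) F).map g.right)
        *ᵥ (fun i => g.right (h.right (v i))) =
      (g.left : Matrix (Fin n) (Fin n) F) *ᵥ
        fun i => g.right (((h.left : Matrix (Fin n) (Fin n) F) *ᵥ fun i => h.right (v i)) i)
    rw [← Matrix.mulVec_mulVec]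
    congr 1
    ext i
    simp [Matrix.mulVec, dotProduct]

theorem GammaL.smul_vec_def {n : ℕ} (g : GammaL n F) (v : Fin n → F) :
    g • v = (g.left : Matrix (Fin n) (Fin n) F) *ᵥ fun i => g.right (v i) := rfl

theorem GammaL.smul_add' {n : ℕ} (g : GammaL n F) (v w : Fin n → F) :
    g • (v + w) = g • v + g • w := by
  simp only [GammaL.smul_vec_def, ← Matrix.mulVec_add]
  congr 1
  ext i
  simp

theorem GammaL.smul_smul' {n : ℕ} (g : GammaL n F) (c : F) (v : Fin n → F) :
    g • (c • v) = g.right c • (g • v) := by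
  simp only [GammaL.smul_vec_def, ← Matrix.mulVec_smul]
  congr 1
  ext i
  simp

/-- The induced action of `ΓL(n, F)` on the subspaces of `Fⁿ`, that is, on the projective space:
a subspace `W` is sent to its image `{g • w | w ∈ W}`. -/
instance GammaL.subspaceAction {n : ℕ} : MulAction (GammaL n F) (Submodule F (Fin n → F)) where
  smul g W :=
    { carrier := (fun v => g • v) '' (W : Set (Fin n → F))
      add_mem' := by
        rintro _ _ ⟨v, hv, rfl⟩ ⟨w, hw, rfl⟩
        exact ⟨v + w, W.add_mem hv hw, GammaL.smul_add' g v w⟩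
      zero_mem' := ⟨0, W.zero_mem, by
        have h := GammaL.smul_smul' g 0 (0 : Fin n → F)
        simpa using h⟩
      smul_mem' := by
        rintro c _ ⟨v, hv, rfl⟩
        refine ⟨g.right.symm c • v, W.smul_mem _ hv, ?_⟩
        have h := GammaL.smul_smul' g (g.right.symm c) v
        simpa using h }
  one_smul W := by
    apply SetLike.coe_injective
    change (fun v => (1 : GammaL n F) • v) '' (W : Set (Fin n → F)) = W
    simp
  mul_smul g h W := by
    apply SetLike.coe_injective
    change (fun v => (g * h) • v) '' (W : Set (Fin n → F)) =
      (fun v => g • v) '' ((fun v => h • v) '' (W : Set (Fin n → F)))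
    rw [Set.image_image]
    simp only [mul_smul]

theorem GammaL.coe_smul_subspace {n : ℕ} (g : GammaL n F) (W : Submodule F (Fin n → F)) :
    ((g • W : Submodule F (Fin n → F)) : Set (Fin n → F)) = (fun v => g • v) '' W := rfl

/-- The action of `ΓL(2, F)` on the projective line `F ∪ {∞}`:
`(A, τ)` acts as `x ↦ (a τ(x) + b) / (c τ(x) + d)`, where `τ(∞) = ∞`. -/
instance GammaL.lineAction [DecidableEq F] : MulAction (GammaL 2 F) (OnePoint F) where
  smul g x := g.left • x.map g.right
  one_smul x := by
    change (1 : GL (Fin 2) F) • x.map (1 : RingAut F) = x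
    rw [one_smul]
    cases x <;> rfl
  mul_smul g h x := by
    change (g.left * autGL 2 F g.right h.left) • x.map (g.right * h.right : RingAut F) =
      g.left • (h.left • x.map h.right).map g.right
    rw [mul_smul]
    congr 1
    have := OnePoint.map_smul (g.right : F →+* F) h.left (x.map h.right)
    refine Eq.trans ?_ this.symm
    congr 1
    cases x <;> rfl

theorem GammaL.smul_line_def [DecidableEq F] (g : GammaL 2 F) (x : OnePoint F) :
    g • x = g.left • x.map g.right := rfl

theorem isSquare_mul_iff_of_finite [Finite F] {a b : F} (ha : a ≠ 0) (hb : b ≠ 0) :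
    IsSquare (a * b) ↔ (IsSquare a ↔ IsSquare b) := by
  classical
  have := Fintype.ofFinite F
  by_cases h2 : ringChar F = 2
  · simp [FiniteField.isSquare_of_char_two h2]
  · rw [← quadraticChar_one_iff_isSquare (mul_ne_zero ha hb), ← quadraticChar_one_iff_isSquare ha,
      ← quadraticChar_one_iff_isSquare hb, map_mul]
    rcases quadraticChar_dichotomy ha with h | h <;>
      rcases quadraticChar_dichotomy hb with h' | h' <;> simp [h, h']

theorem isSquare_ringAut_iff (τ : RingAut F) (a : F) : IsSquare (τ a) ↔ IsSquare a := by
  constructor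
  · intro h
    simpa using h.map τ.symm
  · exact fun h => h.map τ

theorem det_autGL {n : ℕ} (τ : RingAut F) (A : GL (Fin n) F) :
    (autGL n F τ A : Matrix (Fin n) (Fin n) F).det = τ (A : Matrix (Fin n) (Fin n) F).det :=
  (RingHom.map_det (τ : F →+* F) (A : Matrix (Fin n) (Fin n) F)).symm

/-- The subgroup of `ΓL(2, F)` of the pairs `(A, 1)` with `det A` a square and the pairs `(A, σ)`
with `det A` a non-square, where `σ` is an involutory automorphism of the finite field `F`. -/
def twistedGammaL [Finite F] (σ : RingAut F) (hσ : orderOf σ = 2) : Subgroup (GammaL 2 F) where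
  carrier := {g | (g.right = 1 ∧ IsSquare (g.left : Matrix (Fin 2) (Fin 2) F).det) ∨
    (g.right = σ ∧ ¬ IsSquare (g.left : Matrix (Fin 2) (Fin 2) F).det)}
  one_mem' := Or.inl ⟨rfl, by simp⟩
  mul_mem' := by
    intro g h hg hh
    have h2 : σ * σ = 1 := by rw [← sq, ← hσ, pow_orderOf_eq_one]
    have hd : IsSquare (((g * h).left : GL (Fin 2) F) : Matrix (Fin 2) (Fin 2) F).det ↔
        (IsSquare (g.left : Matrix (Fin 2) (Fin 2) F).det ↔
          IsSquare (h.left : Matrix (Fin 2) (Fin 2) F).det) := by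
      rw [SemidirectProduct.mul_left, Units.val_mul, Matrix.det_mul, isSquare_mul_iff_of_finite
        g.left.det_ne_zero (Matrix.GeneralLinearGroup.det_ne_zero _), det_autGL,
        isSquare_ringAut_iff]
    simp only [Set.mem_ofPred_eq, SemidirectProduct.mul_right, hd] at *
    rcases hg with ⟨a, b⟩ | ⟨a, b⟩ <;> rcases hh with ⟨c, d⟩ | ⟨c, d⟩ <;>
      simp [a, b, c, d, h2]
  inv_mem' := by
    intro g hg
    have h2 : σ * σ = 1 := by rw [← sq, ← hσ, pow_orderOf_eq_one]
    have hd : IsSquare (((g⁻¹).left : GL (Fin 2) F) : Matrix (Fin 2) (Fin 2) F).det ↔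
        IsSquare (g.left : Matrix (Fin 2) (Fin 2) F).det := by
      rw [SemidirectProduct.inv_left, det_autGL, isSquare_ringAut_iff, Matrix.coe_units_inv,
        Matrix.det_nonsing_inv, Ring.inverse_eq_inv', isSquare_inv]
    simp only [Set.mem_ofPred_eq, SemidirectProduct.inv_right, hd] at *
    rcases hg with ⟨a, b⟩ | ⟨a, b⟩
    · exact Or.inl ⟨by simp [a], b⟩
    · exact Or.inr ⟨by rw [a]; exact inv_eq_of_mul_eq_one_left h2, b⟩

/-- The twisted group `M(q)`, as a group of permutations of the projective line `F ∪ {∞}`: the maps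
`x ↦ (a x + b) / (c x + d)` with `a d - b c` a nonzero square and the maps
`x ↦ (a σ(x) + b) / (c σ(x) + d)` with `a d - b c` a non-square. -/
def twistedM [Finite F] [DecidableEq F] (σ : RingAut F) (hσ : orderOf σ = 2) :
    Subgroup (Equiv.Perm (OnePoint F)) :=
  (twistedGammaL σ hσ).map (MulAction.toPermHom (GammaL 2 F) (OnePoint F))

/-- The homomorphism `ρ` from `2 × 2` matrices to `3 × 3` matrices. -/
def rhoMatrix (F : Type*) [Field F] : Matrix (Fin 2) (Fin 2) F →* Matrix (Fin 3) (Fin 3) F where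
  toFun A := !![A 0 0 ^ 2, 2 * A 0 0 * A 0 1, A 0 1 ^ 2;
    A 0 0 * A 1 0, A 0 0 * A 1 1 + A 0 1 * A 1 0, A 0 1 * A 1 1;
    A 1 0 ^ 2, 2 * A 1 0 * A 1 1, A 1 1 ^ 2]
  map_one' := by
    ext i j
    fin_cases i <;> fin_cases j <;> simp
  map_mul' A B := by
    ext i j
    fin_cases i <;> fin_cases j <;> simp [Matrix.mul_apply, Fin.sum_univ_succ] <;> ring

/-- The homomorphism `(A, τ) ↦ (ρ(A), τ)` from `ΓL(2, F)` to `ΓL(3, F)`. -/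
def rho (F : Type*) [Field F] : GammaL 2 F →* GammaL 3 F :=
  SemidirectProduct.map (Units.map (rhoMatrix F)) (MonoidHom.id _) (by
    intro τ
    ext A i j
    fin_cases i <;> fin_cases j <;> simp [autGL, rhoMatrix, map_ofNat τ 2])

/-- The point `P_x` of the projective plane (a one-dimensional subspace of `F³`): `(ξ² : ξ : 1)` for
`x = ξ` in `F`, and `(1 : 0 : 0)` for `x = ∞`. -/
def conicPoint (x : OnePoint F) : Submodule F (Fin 3 → F) :=
  x.elim (F ∙ ![1, 0, 0]) fun ξ => F ∙ ![ξ ^ 2, ξ, 1]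

/-- The conic, as a set of points of the projective plane. -/
def conic (F : Type*) [Field F] : Set (Submodule F (Fin 3 → F)) :=
  Set.range conicPoint

/-- The set `𝓛₊` of hyperbolic lines: the lines of the projective plane (two-dimensional subspaces
of `F³`) that contain exactly two points of the conic. -/
def hyperbolicLines (F : Type*) [Field F] : Set (Submodule F (Fin 3 → F)) :=
  {L | Module.finrank F L = 2 ∧ {P | P ∈ conic F ∧ P ≤ L}.ncard = 2}

/-- The image of `M(q)` under the embedding induced by `ρ`, as a group of permutations of the
projective plane, that is, of the subspaces of `F³`. -/
def rhoTwistedM [Finite F] (σ : RingAut F) (hσ : orderOf σ = 2) :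
    Subgroup (Equiv.Perm (Submodule F (Fin 3 → F))) :=
  ((twistedGammaL σ hσ).map (rho F)).map
    (MulAction.toPermHom (GammaL 3 F) (Submodule F (Fin 3 → F)))

theorem GammaL.smul_span {n : ℕ} (g : GammaL n F) (v : Fin n → F) :
    g • (F ∙ v) = F ∙ (g • v) := by
  apply SetLike.coe_injective
  rw [GammaL.coe_smul_subspace]
  ext w
  simp only [Set.mem_image, SetLike.mem_coe, Submodule.mem_span_singleton]
  constructor
  · rintro ⟨_, ⟨c, rfl⟩, rfl⟩
    exact ⟨g.right c, (GammaL.smul_smul' g c v).symm⟩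
  · rintro ⟨c, rfl⟩
    exact ⟨g.right.symm c • v, ⟨_, rfl⟩, by rw [GammaL.smul_smul']; simp⟩

theorem rho_smul_vec (g : GammaL 2 F) (x y z : F) {a b c d : F}
    (hg : (g.left : Matrix (Fin 2) (Fin 2) F) = !![a, b; c, d]) :
    rho F g • ![x, y, z] =
      ![a ^ 2 * g.right x + 2 * a * b * g.right y + b ^ 2 * g.right z,
        a * c * g.right x + (a * d + b * c) * g.right y + b * d * g.right z,
        c ^ 2 * g.right x + 2 * c * d * g.right y + d ^ 2 * g.right z] := by
  change rhoMatrix F (g.left : Matrix (Fin 2) (Fin 2) F) *ᵥ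
    (fun i => g.right (![x, y, z] i)) = _
  rw [hg]
  ext i
  fin_cases i <;> simp [rhoMatrix, Matrix.mulVec, dotProduct, Fin.sum_univ_succ] <;> ring

theorem rho_smul_conicPoint [DecidableEq F] (g : GammaL 2 F) (x : OnePoint F) :
    rho F g • conicPoint x = conicPoint (g • x) := by
  have hspan : ∀ (c : F) (v w : Fin 3 → F), c ≠ 0 → v = c • w → (F ∙ v) = (F ∙ w) := by
    rintro c v w hc rfl
    exact Submodule.span_singleton_smul_eq (IsUnit.mk0 c hc) w
  have hdet := g.left.det_ne_zero
  obtain ⟨a, b, c, d, hg⟩ : ∃ a b c d, (g.left : Matrix (Fin 2) (Fin 2) F) = !![a, b; c, d] :=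
    ⟨_, _, _, _, Matrix.eta_fin_two _⟩
  have h00 : (g.left : Matrix (Fin 2) (Fin 2) F) 0 0 = a := by simp [hg]
  have h01 : (g.left : Matrix (Fin 2) (Fin 2) F) 0 1 = b := by simp [hg]
  have h10 : (g.left : Matrix (Fin 2) (Fin 2) F) 1 0 = c := by simp [hg]
  have h11 : (g.left : Matrix (Fin 2) (Fin 2) F) 1 1 = d := by simp [hg]
  rw [Matrix.det_fin_two, h00, h01, h10, h11] at hdet
  rw [GammaL.smul_line_def]
  cases x with
  | infty =>
    change rho F g • (F ∙ ![1, 0, 0]) = conicPoint (g.left • (∞ : OnePoint F))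
    rw [GammaL.smul_span, OnePoint.smul_infty_eq_ite, rho_smul_vec g _ _ _ hg, h00, h10]
    split_ifs with h
    · refine hspan (a ^ 2) _ _ (pow_ne_zero _ ?_) ?_
      · rintro rfl
        simp [h] at hdet
      · ext i
        fin_cases i <;> simp [h]
    · refine hspan (c ^ 2) _ _ (pow_ne_zero _ h) ?_
      ext i
      fin_cases i <;> simp <;> field_simp
  | coe ξ =>
    change rho F g • (F ∙ ![ξ ^ 2, ξ, 1]) = conicPoint (g.left • ((g.right ξ : F) : OnePoint F))
    rw [GammaL.smul_span, OnePoint.smul_some_eq_ite, rho_smul_vec g _ _ _ hg, h00, h01, h10, h11]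
    generalize hη : g.right ξ = η
    split_ifs with h
    · refine hspan ((a * η + b) ^ 2) _ _ (pow_ne_zero _ ?_) ?_
      · intro h0
        apply hdet
        linear_combination a * h - c * h0
      · ext i
        fin_cases i <;> simp [hη]
        · ring
        · linear_combination (a * η + b) * h
        · linear_combination (c * η + d) * h
    · refine hspan ((c * η + d) ^ 2) _ _ (pow_ne_zero _ h) ?_
      obtain ⟨k, hk⟩ : ∃ k, k * (c * η + d) = a * η + b := ⟨_, div_mul_cancel₀ _ h⟩
      rw [← hk, mul_div_cancel_right₀ _ h]
      ext i
      fin_cases i <;> simp [hη]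
      · linear_combination -(a * η + b + k * (c * η + d)) * hk
      · linear_combination -(c * η + d) * hk
      · ring

theorem GammaL.smul_le_smul {n : ℕ} (g : GammaL n F) {V W : Submodule F (Fin n → F)} :
    g • V ≤ g • W ↔ V ≤ W := by
  rw [← SetLike.coe_subset_coe, GammaL.coe_smul_subspace, GammaL.coe_smul_subspace,
    Set.image_subset_image_iff (MulAction.injective g), SetLike.coe_subset_coe]

theorem GammaL.finrank_smul {n : ℕ} (g : GammaL n F) (W : Submodule F (Fin n → F)) :
    Module.finrank F (g • W : Submodule F (Fin n → F)) = Module.finrank F W := by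
  let j : W ≃+ (g • W : Submodule F (Fin n → F)) :=
    { Equiv.Set.image (fun v => g • v) (W : Set (Fin n → F)) (MulAction.injective g) with
      map_add' := fun v w => Subtype.ext (GammaL.smul_add' g v w) }
  have := rank_eq_of_equiv_equiv (g.right : F → F) j g.right.bijective
    (fun c v => Subtype.ext (GammaL.smul_smul' g c v))
  simp only [Module.finrank, this]

theorem rho_smul_mem_conic (g : GammaL 2 F) {P : Submodule F (Fin 3 → F)} (hP : P ∈ conic F) :
    rho F g • P ∈ conic F := by
  classical
  obtain ⟨x, rfl⟩ := hP
  exact ⟨g • x, (rho_smul_conicPoint g x).symm⟩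

theorem rho_smul_mem_hyperbolicLines (g : GammaL 2 F) {L : Submodule F (Fin 3 → F)}
    (hL : L ∈ hyperbolicLines F) : rho F g • L ∈ hyperbolicLines F := by
  refine ⟨(GammaL.finrank_smul _ _).trans hL.1, ?_⟩
  have : {P | P ∈ conic F ∧ P ≤ rho F g • L} =
      (fun P => rho F g • P) '' {P | P ∈ conic F ∧ P ≤ L} := by
    ext P
    constructor
    · rintro ⟨h1, h2⟩
      refine ⟨rho F g⁻¹ • P, ⟨rho_smul_mem_conic _ h1, ?_⟩, by simp⟩
      rw [← GammaL.smul_le_smul (rho F g)]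
      simpa using h2
    · rintro ⟨P, ⟨h1, h2⟩, rfl⟩
      exact ⟨rho_smul_mem_conic _ h1, (GammaL.smul_le_smul _).2 h2⟩
  rw [this, Set.ncard_image_of_injective _ (MulAction.injective _), hL.2]

/-- The action of the image of `M(q)` on the set `𝓛₊` of hyperbolic lines. -/
instance hyperbolicLinesAction [Finite F] (σ : RingAut F) (hσ : orderOf σ = 2) :
    MulAction (rhoTwistedM σ hσ) (hyperbolicLines F) where
  smul g L := ⟨(g : Equiv.Perm (Submodule F (Fin 3 → F))) L, by
    obtain ⟨_, ⟨_, ⟨h, _, rfl⟩, rfl⟩⟩ := g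
    exact rho_smul_mem_hyperbolicLines h L.2⟩
  one_smul _ := rfl
  mul_smul _ _ _ := rfl

end Semilinear

/-! ### Orbital schemes of transitive groups, and their transport along bijections -/

section OrbitalSchemes

variable {G H X Y : Type*} [Group G] [MulAction G X] [Group H] [MulAction H Y]
  {Z : Type*}

/-! The map x ↦ P_x from the projective line onto the conic is equivariant, and a hyperbolic line is
determined by its two conic points. Hence 𝓛₊ and Ω are the same set for the group `twistedGammaL`,
whose images are the two permutation groups in question, and everything can be proved for that one
group on Ω. The orbitals of a transitive group on a finite set always form an association scheme, so
what remains is to classify and count them.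

The group is transitive on triples of distinct points: GL(2,q) is, and a matrix of non-square
determinant can be corrected by σ, which fixes ∞, 0 and 1. Two distinct pairs can therefore be moved
to {∞,0} and {1,t} with t ≠ 1. The stabilizer of {∞,0} consists of the maps kτ(x) and k/τ(x), with τ
= 1 or σ according to the square class of k. So, for t ≠ 0, t determines the orbital up to inversion
and, only when t is a non-square, up to σ as well (`crossOrbital_eq_iff`). The classes are: the
diagonal, t = 0, t = -1, the other squares in twos and the non-squares in fours. This gives 3 +
(q-5)/4 + (q-1)/8 = (3q+13)/8 orbitals.

Exchanging the two pairs is done by (x-1)/(x-t), of determinant 1-t, which turns t into 1/t. If 1-t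
is a non-square, σ has to be applied too and the parameter becomes σ(1/t). For a square t with σ(t)
≠ t, 1/t this is another orbital. Such a t exists when r = √q exceeds 3.

For q = 9 nonzero squares satisfy σ(t) = t³ = 1/t, so σ preserves every orbital and all relations
are symmetric. There are five. In the graph of the relation t = -1 the neighbours of {∞,0} are the
four pairs {c,-c}; one representative of each orbital then gives the three-term recurrence of a
distance-regular graph of diameter 4, whence the polynomials. -/

theorem orbitals_eq_classes : orbitals G X = (MulAction.orbitRel G (X × X)).classes := by
  ext R
  constructor
  · rintro ⟨p, rfl⟩
    exact ⟨p, Set.ext fun q => Iff.rfl⟩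
  · rintro ⟨p, rfl⟩
    exact ⟨p, Set.ext fun q => Iff.rfl⟩

theorem isPartition_orbitals : Setoid.IsPartition (orbitals G X) := by
  rw [orbitals_eq_classes]
  exact Setoid.isPartition_classes _

theorem eq_orbit_of_mem_orbitals {R : Set (X × X)} (hR : R ∈ orbitals G X) {p : X × X}
    (hp : p ∈ R) : R = MulAction.orbit G p := by
  obtain ⟨q, rfl⟩ := hR
  exact (MulAction.orbit_eq_iff.2 hp).symm

theorem smul_mem_orbital_iff {R : Set (X × X)} (hR : R ∈ orbitals G X) (g : G) {x y : X} :
    (g • x, g • y) ∈ R ↔ (x, y) ∈ R := by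
  obtain ⟨q, rfl⟩ := hR
  constructor
  · rintro ⟨k, hk⟩
    exact ⟨g⁻¹ * k, (mul_smul _ _ _).trans (inv_smul_eq_iff.2 hk)⟩
  · rintro ⟨k, hk⟩
    exact ⟨g * k, (mul_smul _ _ _).trans (congrArg (g • ·) hk)⟩

theorem orbit_diagonal_eq [MulAction.IsPretransitive G X] (x : X) :
    MulAction.orbit G (x, x) = Set.diagonal X := by
  ext ⟨y, z⟩
  constructor
  · rintro ⟨g, hg⟩
    obtain ⟨rfl, rfl⟩ := Prod.ext_iff.1 hg
    rfl
  · rintro (rfl : y = z)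
    obtain ⟨g, rfl⟩ := MulAction.exists_smul_eq G x y
    exact ⟨g, rfl⟩

theorem swap_preimage_orbit (x y : X) :
    Prod.swap ⁻¹' MulAction.orbit G (x, y) = MulAction.orbit G (y, x) := by
  ext ⟨u, v⟩
  constructor <;> rintro ⟨g, hg⟩ <;> obtain ⟨h1, h2⟩ := Prod.ext_iff.1 hg <;>
    exact ⟨g, Prod.ext h2 h1⟩

/-- Transitivity makes the diagonal a single orbit. Intersection numbers are constant because g
carries the intermediate points for (x₀, y₀) bijectively to those for (g x₀, g y₀). -/
theorem isAssociationScheme_orbitals [Finite X] [MulAction.IsPretransitive G X] {d : ℕ}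
    (h2 : 2 ≤ Nat.card X) (hd : (orbitals G X).ncard = d + 1) :
    IsAssociationScheme (orbitals G X) d where
  finite := inferInstance
  two_le_card := h2
  card_relations := hd
  isPartition := isPartition_orbitals
  diagonal_mem := by
    have : Nonempty X := (Nat.card_pos_iff.1 (by omega)).1
    obtain ⟨x⟩ := this
    exact ⟨(x, x), orbit_diagonal_eq x⟩
  inverse_mem := by
    rintro _ ⟨⟨x, y⟩, rfl⟩
    exact ⟨(y, x), (swap_preimage_orbit x y).symm⟩
  intersection_number := by
    rintro R hR S hS _ ⟨⟨x₀, y₀⟩, rfl⟩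
    refine ⟨{z : X | (x₀, z) ∈ R ∧ (z, y₀) ∈ S}.ncard, ?_⟩
    rintro x y ⟨g, hg⟩
    obtain ⟨rfl, rfl⟩ := Prod.ext_iff.1 hg
    rw [← Set.ncard_image_of_injective {z : X | (x₀, z) ∈ R ∧ (z, y₀) ∈ S} (MulAction.injective g)]
    congr 1
    ext z
    constructor
    · rintro ⟨h1, h3⟩
      refine ⟨g⁻¹ • z, ⟨?_, ?_⟩, smul_inv_smul g z⟩
      · rw [← smul_mem_orbital_iff hR g]
        simpa using h1
      · rw [← smul_mem_orbital_iff hS g]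
        simpa using h3
    · rintro ⟨z, ⟨h1, h3⟩, rfl⟩
      exact ⟨(smul_mem_orbital_iff hR g).2 h1, (smul_mem_orbital_iff hS g).2 h3⟩

/-- The relation on `Y` that corresponds to a relation on `X` under a bijection. -/
def transportRelation (e : X ≃ Y) (R : Set (X × X)) : Set (Y × Y) :=
  Prod.map e.symm e.symm ⁻¹' R

theorem mem_transportRelation (e : X ≃ Y) (R : Set (X × X)) (x y : Y) :
    (x, y) ∈ transportRelation e R ↔ (e.symm x, e.symm y) ∈ R := Iff.rfl

theorem transportRelation_injective (e : X ≃ Y) :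
    Function.Injective (transportRelation e) :=
  Set.preimage_injective.2 (e.symm.surjective.prodMap e.symm.surjective)

theorem transportRelation_diagonal (e : X ≃ Y) :
    transportRelation e (Set.diagonal X) = Set.diagonal Y := by
  ext ⟨x, y⟩
  exact e.symm.apply_eq_iff_eq

/-- Orbits depend only on the permutations induced, so φ need only be a surjective map. This allows
passing from a permutation group to the matrix group above it. -/
theorem orbitals_eq_image_transportRelation {φ : G → H} (hφ : Function.Surjective φ) (e : X ≃ Y)
    (h : ∀ g x, e (g • x) = φ g • e x) :
    orbitals H Y = transportRelation e '' orbitals G X := by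
  have key : ∀ x y : X, transportRelation e (MulAction.orbit G (x, y)) =
      MulAction.orbit H (e x, e y) := by
    intro x y
    ext ⟨u, v⟩
    rw [mem_transportRelation]
    constructor
    · rintro ⟨g, hg⟩
      obtain ⟨h1, h2⟩ := Prod.ext_iff.1 hg
      refine ⟨φ g, Prod.ext ?_ ?_⟩
      · exact (h g x).symm.trans ((Equiv.eq_symm_apply e).1 h1)
      · exact (h g y).symm.trans ((Equiv.eq_symm_apply e).1 h2)
    · rintro ⟨k, hk⟩
      obtain ⟨g, rfl⟩ := hφ k
      obtain ⟨h1, h2⟩ := Prod.ext_iff.1 hk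
      refine ⟨g, Prod.ext ?_ ?_⟩
      · exact (Equiv.eq_symm_apply e).2 ((h g x).trans h1)
      · exact (Equiv.eq_symm_apply e).2 ((h g y).trans h2)
  ext R
  constructor
  · rintro ⟨⟨x, y⟩, rfl⟩
    refine ⟨_, ⟨(e.symm x, e.symm y), rfl⟩, ?_⟩
    simp [key]
  · rintro ⟨_, ⟨⟨x, y⟩, rfl⟩, rfl⟩
    exact ⟨(e x, e y), (key x y).symm⟩

theorem IsAssociationScheme.transport {𝓡 : Set (Set (X × X))} {d : ℕ}
    (h : IsAssociationScheme 𝓡 d) (e : X ≃ Y) :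
    IsAssociationScheme (transportRelation e '' 𝓡) d where
  finite := by
    have := h.finite
    exact Finite.of_equiv X e
  two_le_card := (Nat.card_congr e).symm ▸ h.two_le_card
  card_relations := by
    rw [Set.ncard_image_of_injective _ (transportRelation_injective e), h.card_relations]
  isPartition := by
    refine ⟨?_, fun a => ?_⟩
    · rintro ⟨R, hR, hR'⟩
      obtain ⟨⟨x, y⟩, hxy⟩ := Setoid.nonempty_of_mem_partition h.isPartition hR
      have : (e x, e y) ∈ transportRelation e R := by
        simpa [mem_transportRelation] using hxy
      rw [hR'] at this
      exact this
    · obtain ⟨R, ⟨hR, ha⟩, huniq⟩ := h.isPartition.2 (Prod.map e.symm e.symm a)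
      refine ⟨transportRelation e R, ⟨⟨R, hR, rfl⟩, ha⟩, ?_⟩
      rintro _ ⟨⟨S, hS, rfl⟩, haS⟩
      rw [huniq S ⟨hS, haS⟩]
  diagonal_mem := ⟨_, h.diagonal_mem, transportRelation_diagonal e⟩
  inverse_mem := by
    rintro _ ⟨R, hR, rfl⟩
    exact ⟨_, h.inverse_mem R hR, rfl⟩
  intersection_number := by
    rintro _ ⟨R, hR, rfl⟩ _ ⟨S, hS, rfl⟩ _ ⟨T, hT, rfl⟩
    obtain ⟨n, hn⟩ := h.intersection_number R hR S hS T hT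
    refine ⟨n, fun x y hxy => ?_⟩
    rw [← hn _ _ hxy, ← Set.ncard_image_of_injective _ e.symm.injective]
    congr 1
    ext z
    constructor
    · rintro ⟨z, hz, rfl⟩
      exact hz
    · intro hz
      exact ⟨e z, by simpa [mem_transportRelation] using hz, by simp⟩

theorem isSymmetricFamily_transport_iff {𝓡 : Set (Set (X × X))} (e : X ≃ Y) :
    IsSymmetricFamily (transportRelation e '' 𝓡) ↔ IsSymmetricFamily 𝓡 := by
  constructor
  · intro h R hR
    exact transportRelation_injective e (h _ ⟨R, hR, rfl⟩)
  · rintro h _ ⟨R, hR, rfl⟩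
    exact congrArg (transportRelation e) (h R hR)

theorem adjacencyMatrix_transportRelation [Fintype X] [Fintype Y] [DecidableEq X] [DecidableEq Y]
    (e : X ≃ Y) (R : Set (X × X)) : adjacencyMatrix (transportRelation e R) =
      Matrix.reindexAlgEquiv ℂ ℂ e (adjacencyMatrix R) := by
  ext x y
  rfl

theorem IsPPolynomialScheme.transport {𝓡 : Set (Set (X × X))} {d : ℕ}
    (h : IsPPolynomialScheme 𝓡 d) (e : X ≃ Y) :
    IsPPolynomialScheme (transportRelation e '' 𝓡) d := by
  obtain ⟨h1, h2, hX, R, hR, hR0, hpoly⟩ := h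
  refine ⟨h1.transport e, (isSymmetricFamily_transport_iff e).2 h2, Fintype.ofEquiv X e,
    fun i => transportRelation e (R i), ?_, ?_, ?_⟩
  · exact ((transportRelation_injective e).injOn.bijOn_image).comp hR
  · simp only [hR0, transportRelation_diagonal]
  · intro i hi
    obtain ⟨v, hv, hA⟩ := hpoly i hi
    refine ⟨v, hv, ?_⟩
    let := Fintype.ofEquiv X e
    classical
    simp only [adjacencyMatrix_transportRelation]
    rw [hA]
    -- Reindexing along `e` is an algebra isomorphism, so it commutes with the evaluation of `v`.
    convert (Polynomial.aeval_algHom_apply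
      (Matrix.reindexAlgEquiv ℂ ℂ e : Matrix X X ℂ →ₐ[ℂ] Matrix Y Y ℂ)
      (adjacencyMatrix (R 1)) v).symm <;> rfl

/-- A scheme with four classes whose adjacency matrices satisfy the three-term recurrence
of the distance matrices of the generalized octagon of order `(2, 1)`. -/
theorem isPPolynomialScheme_of_recurrence [Fintype Z] {𝓡 : Set (Set (Z × Z))}
    (h : IsAssociationScheme 𝓡 4) (hs : IsSymmetricFamily 𝓡) (R : ℕ → Set (Z × Z))
    (hR : Set.BijOn R (Set.Iic 4) 𝓡) (hR0 : R 0 = Set.diagonal Z)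
    (h1 : adjacencyMatrix (R 1) * adjacencyMatrix (R 1) =
      (4 : ℂ) • adjacencyMatrix (R 0) + adjacencyMatrix (R 1) + adjacencyMatrix (R 2))
    (h2 : adjacencyMatrix (R 1) * adjacencyMatrix (R 2) =
      (2 : ℂ) • adjacencyMatrix (R 1) + adjacencyMatrix (R 2) + adjacencyMatrix (R 3))
    (h3 : adjacencyMatrix (R 1) * adjacencyMatrix (R 3) = (2 : ℂ) • adjacencyMatrix (R 2) +
      adjacencyMatrix (R 3) + (2 : ℂ) • adjacencyMatrix (R 4)) :
    IsPPolynomialScheme 𝓡 4 := by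
  classical
  have h0 : adjacencyMatrix (R 0) = 1 := by
    ext x y
    simp [adjacencyMatrix, hR0, Matrix.one_apply]
  -- Each recurrence is solved for its term of highest index; the factor 1/2 in `v₄` inverts the
  -- coefficient 2 of the last matrix. Each step multiplies by X, so the degree grows by one.
  open Polynomial in
  let v₂ : ℂ[X] := X * X - X - C 4
  open Polynomial in
  let v₃ : ℂ[X] := X * v₂ - C 2 * X - v₂
  open Polynomial in
  let v₄ : ℂ[X] := C (1 / 2) * (X * v₃ - C 2 * v₂ - v₃)
  have e2 : adjacencyMatrix (R 2) = Polynomial.aeval (adjacencyMatrix (R 1)) v₂ := by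
    simp only [v₂, map_sub, map_mul, Polynomial.aeval_X, Polynomial.aeval_C, h1, h0,
      Algebra.algebraMap_eq_smul_one]
    abel
  have e3 : adjacencyMatrix (R 3) = Polynomial.aeval (adjacencyMatrix (R 1)) v₃ := by
    simp only [v₃, map_sub, map_mul, Polynomial.aeval_X, Polynomial.aeval_C, ← e2, h2,
      ← Algebra.smul_def]
    abel
  have e4 : adjacencyMatrix (R 4) = Polynomial.aeval (adjacencyMatrix (R 1)) v₄ := by
    simp only [v₄, map_sub, map_mul, Polynomial.aeval_X, Polynomial.aeval_C, ← e2, ← e3, h3,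
      ← Algebra.smul_def]
    module
  refine ⟨h, hs, inferInstance, R, hR, hR0, fun i hi => ?_⟩
  interval_cases i
  · exact ⟨1, by simp, by simp [h0]⟩
  · exact ⟨Polynomial.X, by simp, by simp⟩
  · exact ⟨v₂, by simp only [v₂]; compute_degree!, e2⟩
  · exact ⟨v₃, by simp only [v₃, v₂]; compute_degree!, e3⟩
  · exact ⟨v₄, by simp only [v₄, v₃, v₂]; compute_degree!, e4⟩

end OrbitalSchemes

/-! ### Möbius maps and triple transitivity of GL(2, F) on the projective line -/

section Moebius

variable {F : Type*} [Field F]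

/-- The invertible matrix with rows `(a, b)` and `(c, d)`. -/
noncomputable def moebius (a b c d : F) (h : a * d - b * c ≠ 0) : GL (Fin 2) F :=
  Matrix.GeneralLinearGroup.mkOfDetNeZero !![a, b; c, d] (by rwa [Matrix.det_fin_two_of])

theorem det_moebius {a b c d : F} (h : a * d - b * c ≠ 0) :
    (moebius a b c d h : Matrix (Fin 2) (Fin 2) F).det = a * d - b * c :=
  Matrix.det_fin_two_of _ _ _ _

variable [DecidableEq F]

theorem moebius_smul_infty {a b c d : F} (h : a * d - b * c ≠ 0) :
    moebius a b c d h • (∞ : OnePoint F) = if c = 0 then ∞ else ((a / c : F) : OnePoint F) := by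
  rw [OnePoint.smul_infty_eq_ite]
  rfl

theorem moebius_smul_coe {a b c d : F} (h : a * d - b * c ≠ 0) (x : F) :
    moebius a b c d h • (x : OnePoint F) =
      if c * x + d = 0 then ∞ else (((a * x + b) / (c * x + d) : F) : OnePoint F) := by
  rw [OnePoint.smul_some_eq_ite]
  rfl

theorem exists_smul_eq_infty (x : OnePoint F) : ∃ h : GL (Fin 2) F, h • x = ∞ := by
  cases x with
  | infty => exact ⟨1, one_smul _ _⟩
  | coe x => exact ⟨moebius 0 1 1 (-x) (by simp), by simp [moebius_smul_coe]⟩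

theorem exists_smul_eq_infty_zero {x y : OnePoint F} (hxy : x ≠ y) :
    ∃ h : GL (Fin 2) F, h • x = ∞ ∧ h • y = ((0 : F) : OnePoint F) := by
  obtain ⟨h, hx⟩ := exists_smul_eq_infty x
  obtain ⟨b, hb⟩ : ∃ b : F, (b : OnePoint F) = h • y := by
    refine OnePoint.ne_infty_iff_exists.1 fun hy => hxy ?_
    exact MulAction.injective h (hx.trans hy.symm)
  refine ⟨moebius 1 (-b) 0 1 (by simp) * h, ?_, ?_⟩
  · simp [mul_smul, hx, moebius_smul_infty]
  · simp [mul_smul, ← hb, moebius_smul_coe]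

theorem exists_smul_eq_infty_zero_one {x y z : OnePoint F} (hxy : x ≠ y) (hxz : x ≠ z)
    (hyz : y ≠ z) : ∃ h : GL (Fin 2) F,
      h • x = ∞ ∧ h • y = ((0 : F) : OnePoint F) ∧ h • z = ((1 : F) : OnePoint F) := by
  obtain ⟨h, hx, hy⟩ := exists_smul_eq_infty_zero hxy
  obtain ⟨c, hc⟩ : ∃ c : F, (c : OnePoint F) = h • z := by
    refine OnePoint.ne_infty_iff_exists.1 fun hz => hxz ?_
    exact MulAction.injective h (hx.trans hz.symm)
  have hc0 : c ≠ 0 := by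
    rintro rfl
    exact hyz (MulAction.injective h (hy.trans hc))
  refine ⟨moebius 1 0 0 c (by simpa) * h, ?_, ?_, ?_⟩
  · simp [mul_smul, hx, moebius_smul_infty]
  · simp [mul_smul, hy, moebius_smul_coe, hc0]
  · simp [mul_smul, ← hc, moebius_smul_coe, hc0]

end Moebius

/-! ### Hyperbolic lines as pairs of points of the projective line -/

section HyperbolicLines

variable {F : Type*} [Field F]

theorem conicPoint_infty : conicPoint (∞ : OnePoint F) = F ∙ ![(1 : F), 0, 0] := rfl

theorem conicPoint_coe (ξ : F) : conicPoint (ξ : OnePoint F) = F ∙ ![ξ ^ 2, ξ, 1] := rfl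

theorem conicPoint_injective : Function.Injective (conicPoint : OnePoint F → _) := by
  have key : ∀ (ξ : F) (x : OnePoint F), conicPoint (ξ : OnePoint F) = conicPoint x →
      (ξ : OnePoint F) = x := by
    intro ξ x h
    have hm : ![ξ ^ 2, ξ, 1] ∈ conicPoint x := h ▸ Submodule.mem_span_singleton_self _
    cases x with
    | infty =>
      obtain ⟨c, hc⟩ := Submodule.mem_span_singleton.1 hm
      simpa using congrFun hc 2
    | coe η =>
      obtain ⟨c, hc⟩ := Submodule.mem_span_singleton.1 hm
      have h1 := congrFun hc 1
      have h2 := congrFun hc 2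
      simp at h1 h2
      rw [← h1, h2, one_mul]
  intro x y h
  cases x with
  | infty =>
    cases y with
    | infty => rfl
    | coe η => exact (key η _ h.symm).symm
  | coe ξ => exact key ξ y h

theorem conicPoint_le_smul_iff [DecidableEq F] (g : GammaL 2 F) (x : OnePoint F)
    (L : Submodule F (Fin 3 → F)) : conicPoint (g • x) ≤ rho F g • L ↔ conicPoint x ≤ L := by
  rw [← rho_smul_conicPoint, GammaL.smul_le_smul]

theorem finrank_conicPoint_infty_sup_zero :
    Module.finrank F ↥(conicPoint (∞ : OnePoint F) ⊔ conicPoint ((0 : F) : OnePoint F)) = 2 := by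
  have : conicPoint (∞ : OnePoint F) ⊔ conicPoint ((0 : F) : OnePoint F) =
      Submodule.span F (Set.range ![![(1 : F), 0, 0], ![0, 0, 1]]) := by
    rw [conicPoint_infty, conicPoint_coe, ← Submodule.span_union]
    congr 1
    ext v
    simp
  rw [this, finrank_span_eq_card, Fintype.card_fin]
  rw [LinearIndependent.pair_iff]
  intro s t h
  have h0 := congrFun h 0
  have h2 := congrFun h 2
  simp at h0 h2
  exact ⟨h0, h2⟩

theorem conicPoint_le_infty_sup_zero_iff (x : OnePoint F) :
    conicPoint x ≤ conicPoint (∞ : OnePoint F) ⊔ conicPoint ((0 : F) : OnePoint F) ↔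
      x = ∞ ∨ x = ((0 : F) : OnePoint F) := by
  constructor
  · cases x with
    | infty => simp
    | coe ξ =>
      intro h
      have hm := h (Submodule.mem_span_singleton_self ![ξ ^ 2, ξ, 1])
      obtain ⟨u, hu, v, hv, huv⟩ := Submodule.mem_sup.1 hm
      obtain ⟨a, rfl⟩ := Submodule.mem_span_singleton.1 hu
      obtain ⟨b, rfl⟩ := Submodule.mem_span_singleton.1 hv
      have h1 := congrFun huv 1
      simp at h1
      exact Or.inr (by rw [h1])
  · rintro (rfl | rfl)
    · exact le_sup_left
    · exact le_sup_right

theorem ncard_conicPoint_le {L : Submodule F (Fin 3 → F)} (hL : L ∈ hyperbolicLines F) :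
    {x | conicPoint x ≤ L}.ncard = 2 := by
  rw [← hL.2, ← Set.ncard_image_of_injective _ conicPoint_injective]
  congr 1
  ext P
  constructor
  · rintro ⟨x, hx, rfl⟩
    exact ⟨⟨x, rfl⟩, hx⟩
  · rintro ⟨⟨x, rfl⟩, hx⟩
    exact ⟨x, hx, rfl⟩

/-- The pair of points of the projective line that parametrizes the two points of the conic on a
hyperbolic line. -/
noncomputable def hyperbolicLineEnds (L : hyperbolicLines F) : Set.powersetCard (OnePoint F) 2 :=
  ⟨Set.Finite.toFinset (s := {x | conicPoint x ≤ L.1})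
      (Set.finite_of_ncard_ne_zero (by rw [ncard_conicPoint_le L.2]; simp)),
    (Set.ncard_eq_toFinset_card _ _).symm.trans (ncard_conicPoint_le L.2)⟩

theorem mem_hyperbolicLineEnds (L : hyperbolicLines F) (x : OnePoint F) :
    x ∈ (hyperbolicLineEnds L).1 ↔ conicPoint x ≤ L.1 := by
  simp [hyperbolicLineEnds]

/-- Double transitivity and equivariance reduce both halves to the pair {∞, 0}: the span of P_∞ and
P_0 is a plane in F³ containing no further conic point. -/
theorem hyperbolicLineEnds_bijective : Function.Bijective (hyperbolicLineEnds (F := F)) := by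
  classical
  constructor
  · intro L L' h
    obtain ⟨x, y, hxy, hs⟩ := Finset.card_eq_two.1 (hyperbolicLineEnds L).2
    obtain ⟨k, hx, hy⟩ := exists_smul_eq_infty_zero hxy
    let g : GammaL 2 F := ⟨k, 1⟩
    have hgx : ∀ z : OnePoint F, g • z = k • z := by
      intro z
      rw [GammaL.smul_line_def]
      cases z <;> rfl
    have key : ∀ M : hyperbolicLines F, (hyperbolicLineEnds M).1 = {x, y} →
        conicPoint (∞ : OnePoint F) ⊔ conicPoint ((0 : F) : OnePoint F) = rho F g • M.1 := by
      intro M hM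
      have h1 : conicPoint x ≤ M.1 := by simp [← mem_hyperbolicLineEnds, hM]
      have h2 : conicPoint y ≤ M.1 := by simp [← mem_hyperbolicLineEnds, hM]
      refine Submodule.eq_of_le_of_finrank_eq (sup_le ?_ ?_) ?_
      · rwa [← hx, ← hgx, conicPoint_le_smul_iff]
      · rwa [← hy, ← hgx, conicPoint_le_smul_iff]
      · rw [finrank_conicPoint_infty_sup_zero, GammaL.finrank_smul, M.2.1]
    exact Subtype.ext (MulAction.injective (rho F g) ((key L hs).symm.trans (key L' (h ▸ hs))))
  · intro s
    obtain ⟨x, y, hxy, hs⟩ := Finset.card_eq_two.1 s.2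
    obtain ⟨k, hx, hy⟩ := exists_smul_eq_infty_zero hxy
    let g : GammaL 2 F := ⟨k, 1⟩
    have hgx : ∀ z : OnePoint F, g • z = k • z := by
      intro z
      rw [GammaL.smul_line_def]
      cases z <;> rfl
    let L : Submodule F (Fin 3 → F) :=
      rho F g⁻¹ • (conicPoint (∞ : OnePoint F) ⊔ conicPoint ((0 : F) : OnePoint F))
    have hgL : rho F g • L =
        conicPoint (∞ : OnePoint F) ⊔ conicPoint ((0 : F) : OnePoint F) := by
      simp only [L, map_inv, smul_inv_smul]
    have hmem : ∀ z, conicPoint z ≤ L ↔ z = x ∨ z = y := by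
      intro z
      rw [← conicPoint_le_smul_iff g, hgL, conicPoint_le_infty_sup_zero_iff,
        hgx, ← hx, ← hy, (MulAction.injective k).eq_iff, (MulAction.injective k).eq_iff]
    have hL : L ∈ hyperbolicLines F := by
      refine ⟨by rw [GammaL.finrank_smul, finrank_conicPoint_infty_sup_zero], ?_⟩
      have : {P | P ∈ conic F ∧ P ≤ L} = {conicPoint x, conicPoint y} := by
        ext P
        constructor
        · rintro ⟨⟨z, rfl⟩, hz⟩
          rcases (hmem z).1 hz with rfl | rfl <;> simp
        · rintro (rfl | rfl)
          · exact ⟨⟨x, rfl⟩, (hmem x).2 (Or.inl rfl)⟩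
          · exact ⟨⟨y, rfl⟩, (hmem y).2 (Or.inr rfl)⟩
      rw [this, Set.ncard_pair (conicPoint_injective.ne hxy)]
    refine ⟨⟨L, hL⟩, Subtype.ext ?_⟩
    ext z
    rw [mem_hyperbolicLineEnds, hmem, hs]
    simp

theorem GammaL.smul_hyperbolicLineEnds [DecidableEq F] (g : GammaL 2 F) {L L' : hyperbolicLines F}
    (h : L'.1 = rho F g • L.1) : hyperbolicLineEnds L' = g • hyperbolicLineEnds L := by
  apply Subtype.ext
  ext x
  rw [mem_hyperbolicLineEnds, Set.powersetCard.coe_smul, h, ← Finset.inv_smul_mem_iff,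
    mem_hyperbolicLineEnds, ← conicPoint_le_smul_iff g (g⁻¹ • x), smul_inv_smul]

variable [Finite F] [DecidableEq F] {σ : RingAut F} {hσ : orderOf σ = 2}

theorem orbitals_twistedM : orbitals (twistedM σ hσ) (Set.powersetCard (OnePoint F) 2) =
    orbitals (twistedGammaL σ hσ) (Set.powersetCard (OnePoint F) 2) := by
  rw [orbitals_eq_image_transportRelation (G := twistedGammaL σ hσ)
    (φ := fun g => ⟨MulAction.toPermHom (GammaL 2 F) (OnePoint F) g.1, ⟨g.1, g.2, rfl⟩⟩) ?_
    (Equiv.refl _) ?_]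
  · exact Set.image_id' _
  · rintro ⟨_, ⟨g, hg, rfl⟩⟩
    exact ⟨⟨g, hg⟩, rfl⟩
  · intro g s
    rfl

theorem orbitals_rhoTwistedM : ∃ e : Set.powersetCard (OnePoint F) 2 ≃ hyperbolicLines F,
    orbitals (rhoTwistedM σ hσ) (hyperbolicLines F) = transportRelation e ''
      orbitals (twistedGammaL σ hσ) (Set.powersetCard (OnePoint F) 2) := by
  refine ⟨(Equiv.ofBijective _ hyperbolicLineEnds_bijective).symm, ?_⟩
  refine orbitals_eq_image_transportRelation (φ := fun g : twistedGammaL σ hσ =>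
    ⟨MulAction.toPermHom (GammaL 3 F) (Submodule F (Fin 3 → F)) (rho F g.1),
      ⟨_, ⟨g.1, g.2, rfl⟩, rfl⟩⟩) ?_ _ ?_
  · rintro ⟨_, ⟨_, ⟨g, hg, rfl⟩, rfl⟩⟩
    exact ⟨⟨g, hg⟩, rfl⟩
  · intro g s
    rw [Equiv.symm_apply_eq]
    obtain ⟨L, rfl⟩ := (Equiv.ofBijective _ hyperbolicLineEnds_bijective).surjective s
    rw [Equiv.symm_apply_apply]
    exact (GammaL.smul_hyperbolicLineEnds g.1 rfl).symm

end HyperbolicLines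

/-! ### The involution x ↦ x^r with r² = q, and squares in F -/

section FieldInvolution

variable {F : Type*} [Field F] [Fintype F]

/-- The automorphism group is cyclic of order 2f, generated by Frobenius. If σ is its k-th power
with 0 < k < 2f, then σ² = 1 forces 2f ∣ 2k, hence k = f. -/
theorem exists_involution_eq_pow {p f : ℕ} (hp : p.Prime)
    (hq : Fintype.card F = p ^ (2 * f)) {σ : RingAut F} (hσ : orderOf σ = 2) :
    ∃ r : ℕ, r * r = Fintype.card F ∧ ∀ x, σ x = x ^ r := by
  have : Fact p.Prime := ⟨hp⟩
  have : CharP F p := charP_of_card_eq_prime_pow hq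
  let := ZMod.algebra F p
  have hrank : Module.finrank (ZMod p) F = 2 * f := by
    have := Module.card_eq_pow_finrank (K := ZMod p) (V := F)
    rw [hq, ZMod.card] at this
    exact (Nat.pow_right_injective hp.two_le this).symm
  let τ : F ≃ₐ[ZMod p] F := { σ with
    commutes' := fun c => RingHom.congr_fun
      (Subsingleton.elim ((σ : F →+* F).comp (algebraMap (ZMod p) F)) (algebraMap (ZMod p) F)) c }
  obtain ⟨⟨k, hk⟩, hkτ⟩ := (FiniteField.bijective_frobeniusAlgEquivOfAlgebraic_pow (ZMod p) F).2 τ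
  rw [hrank] at hk
  simp only at hkτ
  have hpow : ∀ x, σ x = x ^ p ^ k := by
    intro x
    have h1 : σ x = τ x := rfl
    rw [h1, ← hkτ, AlgEquiv.coe_pow, FiniteField.coe_frobeniusAlgEquivOfAlgebraic_iterate,
      ZMod.card]
  have hτ2 : τ ^ 2 = 1 := by
    ext x
    have h1 : σ ^ 2 = 1 := by rw [← hσ, pow_orderOf_eq_one]
    exact RingEquiv.congr_fun h1 x
  have hdvd : 2 * f ∣ k * 2 := by
    rw [← hrank, ← FiniteField.orderOf_frobeniusAlgEquivOfAlgebraic, orderOf_dvd_iff_pow_eq_one,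
      pow_mul, hkτ, hτ2]
  have hk0 : k ≠ 0 := by
    rintro rfl
    have : σ = 1 := by
      ext x
      simpa using hpow x
    rw [this, orderOf_one] at hσ
    omega
  have hkf : k = f := by
    obtain ⟨m, hm⟩ := hdvd
    have h1 : k = f * m := by linarith [hm]
    have h2 : m < 2 := by
      by_contra! h
      nlinarith
    interval_cases m <;> omega
  refine ⟨p ^ k, ?_, hpow⟩
  rw [hq, hkf, ← pow_add, two_mul]

variable {r : ℕ}

theorem ringChar_ne_two_of_odd_sqrt_card (hr : r * r = Fintype.card F) (hodd : Odd r) :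
    ringChar F ≠ 2 := by
  intro h
  have h1 := FiniteField.even_card_of_char_two h
  rw [← hr] at h1
  exact Nat.not_even_iff_odd.2 (hodd.mul hodd) (Nat.even_iff.2 h1)

theorem isSquare_neg_one_of_odd_sqrt_card (hr : r * r = Fintype.card F) (hodd : Odd r) :
    IsSquare (-1 : F) := by
  rw [FiniteField.isSquare_neg_one_iff, ← hr]
  obtain ⟨m, rfl⟩ := hodd
  have : (2 * m + 1) * (2 * m + 1) = 4 * (m * m + m) + 1 := by ring
  omega

/-- Elements of the subfield of order r are squares: t^(r-1) = 1, and (q-1)/2 = (r-1)(r+1)/2 is a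
multiple of r-1. Euler's criterion applies. -/
theorem isSquare_of_pow_sub_one_eq_one (hr : r * r = Fintype.card F) (hodd : Odd r) {t : F}
    (h0 : t ≠ 0) (ht : t ^ r = t) : IsSquare t := by
  obtain ⟨m, rfl⟩ := hodd
  rw [FiniteField.isSquare_iff (ringChar_ne_two_of_odd_sqrt_card hr ⟨m, rfl⟩) h0]
  have h1 : t ^ (2 * m) = 1 := by
    rw [pow_succ] at ht
    exact mul_right_cancel₀ h0 (ht.trans (one_mul t).symm)
  have h2 : Fintype.card F / 2 = 2 * m * (m + 1) := by
    have : (2 * m + 1) * (2 * m + 1) = 2 * (2 * m * (m + 1)) + 1 := by ring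
    omega
  rw [h2, pow_mul, h1, one_pow]

/-- Here t^(r+1) = 1, and (q-1)/2 is also a multiple of r+1. -/
theorem isSquare_of_pow_eq_inv (hr : r * r = Fintype.card F) (hodd : Odd r) {t : F}
    (h0 : t ≠ 0) (ht : t ^ r = t⁻¹) : IsSquare t := by
  obtain ⟨m, rfl⟩ := hodd
  rw [FiniteField.isSquare_iff (ringChar_ne_two_of_odd_sqrt_card hr ⟨m, rfl⟩) h0]
  have h1 : t ^ (2 * (m + 1)) = 1 := by
    rw [show 2 * (m + 1) = 2 * m + 1 + 1 by ring, pow_succ, ht, inv_mul_cancel₀ h0]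
  have h2 : Fintype.card F / 2 = 2 * (m + 1) * m := by
    have : (2 * m + 1) * (2 * m + 1) = 2 * (2 * (m + 1) * m) + 1 := by ring
    omega
  rw [h2, pow_mul, h1, one_pow]

/-- Half of the nonzero elements of a finite field of odd order are squares. -/
theorem card_nonzero_squares [DecidableEq F] (hF : ringChar F ≠ 2) :
    2 * (Finset.univ.filter fun t : F => t ≠ 0 ∧ IsSquare t).card + 1 = Fintype.card F ∧
    2 * (Finset.univ.filter fun t : F => ¬ IsSquare t).card + 1 = Fintype.card F := by
  obtain ⟨n, hn⟩ := FiniteField.exists_nonsquare hF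
  have hn0 : n ≠ 0 := by
    rintro rfl
    exact hn IsSquare.zero
  have h1 : (Finset.univ.filter fun t : F => t ≠ 0 ∧ IsSquare t).card =
      (Finset.univ.filter fun t : F => ¬ IsSquare t).card := by
    -- Multiplication by a fixed non-square exchanges nonzero squares and non-squares.
    refine Finset.card_bij' (fun t _ => n * t) (fun t _ => n⁻¹ * t) ?_ ?_ ?_ ?_
    · intro t ht
      simp only [Finset.mem_filter, Finset.mem_univ, true_and] at ht ⊢
      rw [isSquare_mul_iff_of_finite hn0 ht.1]
      tauto
    · intro t ht
      simp only [Finset.mem_filter, Finset.mem_univ, true_and] at ht ⊢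
      have ht0 : t ≠ 0 := by
        rintro rfl
        exact ht IsSquare.zero
      refine ⟨mul_ne_zero (inv_ne_zero hn0) ht0, ?_⟩
      rw [isSquare_mul_iff_of_finite (inv_ne_zero hn0) ht0, isSquare_inv]
      tauto
    · intro t _
      exact inv_mul_cancel_left₀ hn0 t
    · intro t _
      exact mul_inv_cancel_left₀ hn0 t
  have h2 : (Finset.univ.filter fun t : F => IsSquare t).card =
      (Finset.univ.filter fun t : F => t ≠ 0 ∧ IsSquare t).card + 1 := by
    rw [← Finset.card_insert_of_notMem (a := (0 : F)) (by simp)]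
    congr 1
    ext t
    by_cases ht : t = 0 <;> simp [ht]
  have h3 := Finset.card_filter_add_card_filter_not (s := (Finset.univ : Finset F))
    (fun t : F => IsSquare t)
  rw [Finset.card_univ] at h3
  omega

/-- A generator w of the multiplicative group works. The two excluded equations would give
w^(2(r-1)) = 1 or w^(2(r+1)) = 1, and both exponents are below r²-1 once r > 3; for r = 3 the second
one equals r²-1. -/
theorem exists_nonsquare_of_three_lt (hr : r * r = Fintype.card F) (hodd : Odd r) (h3 : 3 < r) :
    ∃ w : F, ¬ IsSquare w ∧ w ^ r ≠ -w ∧ w ^ r ≠ -w⁻¹ := by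
  classical
  obtain ⟨w, hw⟩ := IsCyclic.exists_ofOrder_eq_natCard (α := Fˣ)
  rw [Nat.card_eq_fintype_card, Fintype.card_units, ← hr] at hw
  have hle : ∀ m, 0 < m → (w : F) ^ m = 1 → r * r - 1 ≤ m := by
    intro m hm h
    rw [← hw]
    exact orderOf_le_of_pow_eq_one hm (by ext; simpa using h)
  have h0 : (w : F) ≠ 0 := w.ne_zero
  have hrr : 4 * r ≤ r * r := Nat.mul_le_mul_right _ h3
  refine ⟨w, ?_, ?_, ?_⟩
  · rw [FiniteField.isSquare_iff (ringChar_ne_two_of_odd_sqrt_card hr hodd) h0, ← hr]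
    intro h
    have := hle _ (by omega) h
    omega
  · intro h
    have h1 : (w : F) ^ (2 * (r - 1)) = 1 := by
      have h2 : (w : F) ^ (r - 1) = -1 := by
        apply mul_right_cancel₀ h0
        rw [← pow_succ, Nat.sub_add_cancel (by omega), h]
        ring
      rw [mul_comm, pow_mul, h2]
      ring
    have := hle _ (by omega) h1
    omega
  · intro h
    have h1 : (w : F) ^ ((r + 1) * 2) = 1 := by
      rw [pow_mul, pow_succ (w : F) r, h, neg_mul, inv_mul_cancel₀ h0]
      ring
    have := hle _ (by omega) h1
    omega

end FieldInvolution

/-! ### Classification of the orbitals by the parameter t -/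

section CrossOrbitals

open scoped Pointwise

theorem Finset.pair_eq_pair_iff' {α : Type*} [DecidableEq α] {a b c d : α} :
    ({a, b} : Finset α) = {c, d} ↔ a = c ∧ b = d ∨ a = d ∧ b = c := by
  rw [← Finset.coe_inj]
  simp [Set.pair_eq_pair_iff]

theorem Finset.smul_pair {G α : Type*} [Group G] [MulAction G α] [DecidableEq α] (g : G)
    (a b : α) : g • ({a, b} : Finset α) = {g • a, g • b} := by
  simp [Finset.smul_finset_insert]

variable {F : Type*} [Field F] [Fintype F] [DecidableEq F] {σ : RingAut F} {hσ : orderOf σ = 2}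

/-- A Möbius map of non-square determinant is brought into the group by applying σ after it. Moving
σ past the matrix keeps the square class of the determinant. -/
theorem exists_twistedGammaL_smul_eq (hσ : orderOf σ = 2) (h : GL (Fin 2) F) :
    ∃ g : twistedGammaL σ hσ,
      (IsSquare (h : Matrix (Fin 2) (Fin 2) F).det ∧ ∀ x : OnePoint F, g • x = h • x) ∨
      (¬ IsSquare (h : Matrix (Fin 2) (Fin 2) F).det ∧
        ∀ x : OnePoint F, g • x = (h • x).map σ) := by
  by_cases hd : IsSquare (h : Matrix (Fin 2) (Fin 2) F).det
  · refine ⟨⟨⟨h, 1⟩, Or.inl ⟨rfl, hd⟩⟩, Or.inl ⟨hd, fun x => ?_⟩⟩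
    cases x <;> rfl
  · refine ⟨⟨⟨autGL 2 F σ h, σ⟩, Or.inr ⟨rfl, ?_⟩⟩, Or.inr ⟨hd, fun x => ?_⟩⟩
    · rwa [det_autGL, isSquare_ringAut_iff]
    · exact (OnePoint.map_smul (σ : F →+* F) h x).symm

theorem exists_smul_eq_of_twistedGammaL (g : twistedGammaL σ hσ) :
    ∃ h : GL (Fin 2) F,
      (IsSquare (h : Matrix (Fin 2) (Fin 2) F).det ∧ ∀ x : OnePoint F, g • x = h • x) ∨
      (¬ IsSquare (h : Matrix (Fin 2) (Fin 2) F).det ∧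
        ∀ x : OnePoint F, g • x = h • x.map σ) := by
  obtain ⟨⟨h, τ⟩, ⟨hτ, hd⟩ | ⟨hτ, hd⟩⟩ := g
  · refine ⟨h, Or.inl ⟨hd, fun x => ?_⟩⟩
    change h • x.map τ = h • x
    rw [show τ = 1 from hτ]
    cases x <;> rfl
  · refine ⟨h, Or.inr ⟨hd, fun x => ?_⟩⟩
    change h • x.map τ = h • x.map σ
    rw [show τ = σ from hτ]

/-- The correction by σ is harmless here, since σ fixes ∞, 0 and 1. -/
theorem exists_twistedGammaL_smul_eq_infty_zero_one (hσ : orderOf σ = 2) {x y z : OnePoint F}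
    (hxy : x ≠ y) (hxz : x ≠ z) (hyz : y ≠ z) : ∃ g : twistedGammaL σ hσ,
      g • x = ∞ ∧ g • y = ((0 : F) : OnePoint F) ∧ g • z = ((1 : F) : OnePoint F) := by
  obtain ⟨h, h1, h2, h3⟩ := exists_smul_eq_infty_zero_one hxy hxz hyz
  obtain ⟨g, ⟨-, hg⟩ | ⟨-, hg⟩⟩ := exists_twistedGammaL_smul_eq hσ h
  · exact ⟨g, by rw [hg, h1], by rw [hg, h2], by rw [hg, h3]⟩
  · exact ⟨g, by rw [hg, h1]; rfl, by rw [hg, h2]; simp, by rw [hg, h3]; simp⟩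

/-- The elements of the twisted group that stabilize `{∞, 0}` are the maps `x ↦ k τ(x)` and
`x ↦ k / τ(x)`, where `τ` is trivial if `k` is a square and `τ = σ` otherwise. -/
theorem exists_scaling_of_smul_pair_eq (hneg : IsSquare (-1 : F)) (g : twistedGammaL σ hσ)
    (hg : g • ({∞, ((0 : F) : OnePoint F)} : Finset (OnePoint F)) = {∞, ((0 : F) : OnePoint F)}) :
    ∃ k : F, k ≠ 0 ∧ ∃ τ : RingAut F, (IsSquare k ∧ τ = 1 ∨ ¬ IsSquare k ∧ τ = σ) ∧
      ((∀ x : F, x ≠ 0 → g • (x : OnePoint F) = ((k * τ x : F) : OnePoint F)) ∨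
        (∀ x : F, x ≠ 0 → g • (x : OnePoint F) = ((k * (τ x)⁻¹ : F) : OnePoint F))) := by
  have hform : ∃ (h : GL (Fin 2) F) (τ : RingAut F),
      (IsSquare (h : Matrix (Fin 2) (Fin 2) F).det ∧ τ = 1 ∨
        ¬ IsSquare (h : Matrix (Fin 2) (Fin 2) F).det ∧ τ = σ) ∧
      g • (∞ : OnePoint F) = h • ∞ ∧
      ∀ x : F, g • (x : OnePoint F) = h • ((τ x : F) : OnePoint F) := by
    obtain ⟨h, ⟨hd, hx⟩ | ⟨hd, hx⟩⟩ := exists_smul_eq_of_twistedGammaL g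
    · exact ⟨h, 1, Or.inl ⟨hd, rfl⟩, hx _, fun x => hx _⟩
    · exact ⟨h, σ, Or.inr ⟨hd, rfl⟩, hx _, fun x => hx _⟩
  obtain ⟨h, τ, hτ, hinf, hx⟩ := hform
  have h0 := hx 0
  rw [map_zero, OnePoint.smul_some_eq_ite] at h0
  rw [OnePoint.smul_infty_eq_ite] at hinf
  have hdet := h.det_ne_zero
  rw [Matrix.det_fin_two] at hτ hdet
  simp only [OnePoint.smul_some_eq_ite] at hx
  generalize (h : Matrix (Fin 2) (Fin 2) F) 0 0 = a at *
  generalize (h : Matrix (Fin 2) (Fin 2) F) 0 1 = b at *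
  generalize (h : Matrix (Fin 2) (Fin 2) F) 1 0 = c at *
  generalize (h : Matrix (Fin 2) (Fin 2) F) 1 1 = d at *
  rw [Finset.smul_pair, Finset.pair_eq_pair_iff'] at hg
  rcases hg with ⟨g1, g2⟩ | ⟨g1, g2⟩
  · have hc : c = 0 := by
      by_contra hc
      rw [g1, if_neg hc] at hinf
      exact OnePoint.infty_ne_coe _ hinf
    subst hc
    have hd : d ≠ 0 := by
      rintro rfl
      simp at hdet
    have ha : a ≠ 0 := by
      rintro rfl
      simp at hdet
    have hb : b = 0 := by
      rw [g2] at h0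
      simpa [hd, eq_comm] using h0
    subst hb
    -- The matrix is diagonal, so k = a/d lies in the square class of the determinant ad.
    have hsq : IsSquare (a / d) ↔ IsSquare (a * d - 0 * 0) := by
      rw [mul_zero, sub_zero, div_eq_mul_inv, isSquare_mul_iff_of_finite ha (inv_ne_zero hd),
        isSquare_mul_iff_of_finite ha hd, isSquare_inv]
    refine ⟨a / d, div_ne_zero ha hd, τ, by rwa [hsq], Or.inl fun x _ => ?_⟩
    rw [hx]
    simp [hd]
    ring
  · have hc : c ≠ 0 := by
      rintro rfl
      rw [g1] at hinf
      simp at hinf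
    have ha : a = 0 := by
      rw [g1, if_neg hc] at hinf
      simpa [hc, eq_comm] using hinf
    subst ha
    have hd : d = 0 := by
      by_contra hd
      rw [g2] at h0
      simp [hd] at h0
    subst hd
    have hb : b ≠ 0 := by
      rintro rfl
      simp at hdet
    -- The matrix is antidiagonal with determinant -bc. That -1 is a square puts k = b/c in the same
    -- square class.
    have hsq : IsSquare (b / c) ↔ IsSquare (0 * 0 - b * c) := by
      have : (0 * 0 - b * c) = -1 * (b * c) := by ring
      rw [this, isSquare_mul_iff_of_finite (by simp) (mul_ne_zero hb hc), div_eq_mul_inv,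
        isSquare_mul_iff_of_finite hb (inv_ne_zero hc), isSquare_mul_iff_of_finite hb hc,
        isSquare_inv]
      simp [hneg]
    refine ⟨b / c, div_ne_zero hb hc, τ, by rwa [hsq], Or.inr fun x hx0 => ?_⟩
    have : τ x ≠ 0 := by simpa using hx0
    rw [hx]
    simp [hc, this]
    field_simp

/-- The orbital of the twisted group that contains the pair `({∞, 0}, {1, t})`. -/
def crossOrbital (σ : RingAut F) (hσ : orderOf σ = 2) (t : F) :
    Set (Set.powersetCard (OnePoint F) 2 × Set.powersetCard (OnePoint F) 2) :=
  {p | ∃ g : twistedGammaL σ hσ, g • p.1.1 = {∞, ((0 : F) : OnePoint F)} ∧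
    g • p.2.1 = {((1 : F) : OnePoint F), (t : OnePoint F)}}

theorem mem_crossOrbital {t : F} {s s' : Set.powersetCard (OnePoint F) 2} :
    (s, s') ∈ crossOrbital σ hσ t ↔ ∃ g : twistedGammaL σ hσ,
      g • s.1 = {∞, ((0 : F) : OnePoint F)} ∧
      g • s'.1 = {((1 : F) : OnePoint F), (t : OnePoint F)} := Iff.rfl

/-- The pair `{∞, 0}`. -/
def inftyZero (F : Type*) [Field F] [DecidableEq F] : Set.powersetCard (OnePoint F) 2 :=
  ⟨{∞, ((0 : F) : OnePoint F)}, Finset.card_pair (OnePoint.infty_ne_coe _)⟩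

/-- The pair `{x, y}` of finite points. -/
def finitePair {x y : F} (h : x ≠ y) : Set.powersetCard (OnePoint F) 2 :=
  ⟨{(x : OnePoint F), (y : OnePoint F)}, Finset.card_pair (fun e => h (OnePoint.coe_injective e))⟩

theorem crossOrbital_eq_orbit {t : F} (ht : 1 ≠ t) : crossOrbital σ hσ t =
    MulAction.orbit (twistedGammaL σ hσ) (inftyZero F, finitePair ht) := by
  ext ⟨s, s'⟩
  rw [mem_crossOrbital]
  constructor
  · rintro ⟨g, h1, h2⟩
    refine ⟨g⁻¹, Prod.ext (Subtype.ext ?_) (Subtype.ext ?_)⟩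
    · change g⁻¹ • ({∞, ((0 : F) : OnePoint F)} : Finset _) = s.1
      rw [← h1, inv_smul_smul]
    · change g⁻¹ • ({((1 : F) : OnePoint F), (t : OnePoint F)} : Finset _) = s'.1
      rw [← h2, inv_smul_smul]
  · rintro ⟨g, hg⟩
    obtain ⟨rfl, rfl⟩ := Prod.ext_iff.1 hg
    exact ⟨g⁻¹, inv_smul_smul g _, inv_smul_smul g _⟩

theorem crossOrbital_mem_orbitals {t : F} (ht : 1 ≠ t) : crossOrbital σ hσ t ∈
    orbitals (twistedGammaL σ hσ) (Set.powersetCard (OnePoint F) 2) :=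
  ⟨_, (crossOrbital_eq_orbit ht).symm⟩

theorem mem_crossOrbital_self {t : F} (ht : 1 ≠ t) :
    (inftyZero F, finitePair ht) ∈ crossOrbital σ hσ t :=
  ⟨1, one_smul _ _, one_smul _ _⟩

/-- Choose c in s' outside s, let d be the other point of s', and label s = {a, b} with a ≠ d.
Sending a, b, c to ∞, 0, 1 makes the image t of d finite and different from 1; t = 0 occurs when b =
d. -/
theorem eq_or_exists_mem_crossOrbital (hσ : orderOf σ = 2)
    (s s' : Set.powersetCard (OnePoint F) 2) :
    s = s' ∨ ∃ t : F, 1 ≠ t ∧ (s, s') ∈ crossOrbital σ hσ t := by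
  by_cases hss : s = s'
  · exact Or.inl hss
  refine Or.inr ?_
  obtain ⟨c, hc', hc⟩ := (Set.powersetCard.exists_mem_notMem_iff_ne s' s).1 (Ne.symm hss)
  obtain ⟨d, hcd, hs'⟩ : ∃ d, c ≠ d ∧ s'.1 = {c, d} := by
    obtain ⟨x, y, hxy, hs⟩ := Finset.card_eq_two.1 s'.2
    rw [← Set.powersetCard.mem_coe_iff, hs, Finset.mem_insert, Finset.mem_singleton] at hc'
    rcases hc' with rfl | rfl
    · exact ⟨y, hxy, hs⟩
    · exact ⟨x, hxy.symm, by rw [hs, Finset.pair_comm]⟩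
  obtain ⟨a, b, hab, had, hs⟩ : ∃ a b, a ≠ b ∧ a ≠ d ∧ s.1 = {a, b} := by
    obtain ⟨x, y, hxy, hs⟩ := Finset.card_eq_two.1 s.2
    by_cases hxd : x = d
    · exact ⟨y, x, hxy.symm, fun h => hxy (hxd.trans h.symm), by rw [hs, Finset.pair_comm]⟩
    · exact ⟨x, y, hxy, hxd, hs⟩
  rw [← Set.powersetCard.mem_coe_iff, hs, Finset.mem_insert, Finset.mem_singleton, not_or] at hc
  obtain ⟨g, g1, g2, g3⟩ := exists_twistedGammaL_smul_eq_infty_zero_one hσ hab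
    (Ne.symm hc.1) (Ne.symm hc.2)
  obtain ⟨t, ht⟩ : ∃ t : F, (t : OnePoint F) = g • d := by
    refine OnePoint.ne_infty_iff_exists.1 fun h => had ?_
    exact MulAction.injective g (g1.trans h.symm)
  refine ⟨t, ?_, g, ?_, ?_⟩
  · rintro rfl
    exact hcd (MulAction.injective g (g3.trans ht))
  · rw [hs, Finset.smul_pair, g1, g2]
  · rw [hs', Finset.smul_pair, g3, ht]

/-- Parameters can be computed with any Möbius map, at the price of replacing t by σ(t) when the
determinant is a non-square. -/
theorem mem_crossOrbital_of_GL (h : GL (Fin 2) F) {s s' : Set.powersetCard (OnePoint F) 2} {t : F}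
    (hs : h • s.1 = {∞, ((0 : F) : OnePoint F)})
    (hs' : h • s'.1 = {((1 : F) : OnePoint F), (t : OnePoint F)}) :
    (IsSquare (h : Matrix (Fin 2) (Fin 2) F).det ∧ (s, s') ∈ crossOrbital σ hσ t) ∨
    (¬ IsSquare (h : Matrix (Fin 2) (Fin 2) F).det ∧ (s, s') ∈ crossOrbital σ hσ (σ t)) := by
  obtain ⟨g, ⟨hd, hg⟩ | ⟨hd, hg⟩⟩ := exists_twistedGammaL_smul_eq hσ h
  · refine Or.inl ⟨hd, g, ?_, ?_⟩
    · rw [← hs]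
      exact Finset.image_congr fun x _ => hg x
    · rw [← hs']
      exact Finset.image_congr fun x _ => hg x
  · have hmap : ∀ u : Finset (OnePoint F), g • u = (h • u).image (OnePoint.map σ) := by
      intro u
      rw [Finset.smul_finset_def, Finset.smul_finset_def, Finset.image_image]
      exact Finset.image_congr fun x _ => hg x
    refine Or.inr ⟨hd, g, ?_, ?_⟩
    · rw [hmap, hs]
      simp
    · rw [hmap, hs']
      simp

theorem crossOrbital_eq_iff_exists {t t' : F} (ht : 1 ≠ t) :
    crossOrbital σ hσ t = crossOrbital σ hσ t' ↔ ∃ g : twistedGammaL σ hσ,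
      g • ({∞, ((0 : F) : OnePoint F)} : Finset (OnePoint F)) = {∞, ((0 : F) : OnePoint F)} ∧
      g • ({((1 : F) : OnePoint F), (t : OnePoint F)} : Finset (OnePoint F)) =
        {((1 : F) : OnePoint F), (t' : OnePoint F)} := by
  constructor
  · intro h
    have h1 := mem_crossOrbital_self (σ := σ) (hσ := hσ) ht
    rwa [h] at h1
  · rintro ⟨g, h1, h2⟩
    ext ⟨s, s'⟩
    constructor
    · rintro ⟨k, k1, k2⟩
      exact ⟨g * k, by rw [mul_smul, k1, h1], by rw [mul_smul, k2, h2]⟩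
    · rintro ⟨k, k1, k2⟩
      refine ⟨g⁻¹ * k, ?_, ?_⟩
      · rw [mul_smul, k1, inv_smul_eq_iff, h1]
      · rw [mul_smul, k2, inv_smul_eq_iff, h2]

/-- The map 1/x has determinant -1, a square, so it belongs to the group; it preserves {∞, 0}, fixes
1 and inverts t. -/
theorem crossOrbital_inv (hneg : IsSquare (-1 : F)) {t : F} (ht : 1 ≠ t) (h0 : t ≠ 0) :
    crossOrbital σ hσ t⁻¹ = crossOrbital σ hσ t := by
  symm
  rw [crossOrbital_eq_iff_exists ht]
  obtain ⟨g, ⟨-, hg⟩ | ⟨hd, -⟩⟩ := exists_twistedGammaL_smul_eq hσ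
    (moebius (0 : F) 1 1 0 (by simp))
  · refine ⟨g, ?_, ?_⟩
    · rw [Finset.smul_pair, hg, hg, moebius_smul_coe, moebius_smul_infty]
      simp [Finset.pair_comm]
    · rw [Finset.smul_pair, hg, hg, moebius_smul_coe, moebius_smul_coe]
      simp [h0]
  · rw [det_moebius] at hd
    simp [hneg] at hd

/-- The map t/x preserves {∞, 0} and {1, t}, but its determinant -t is a non-square. Followed by σ
it lies in the group and takes {1, t} to {1, σ(t)}. -/
theorem crossOrbital_involution (hneg : IsSquare (-1 : F)) {t : F} (hsq : ¬ IsSquare t) :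
    crossOrbital σ hσ (σ t) = crossOrbital σ hσ t := by
  have h0 : t ≠ 0 := by
    rintro rfl
    exact hsq IsSquare.zero
  have h1 : 1 ≠ t := by
    rintro rfl
    exact hsq IsSquare.one
  symm
  rw [crossOrbital_eq_iff_exists h1]
  obtain ⟨g, ⟨hd, -⟩ | ⟨-, hg⟩⟩ := exists_twistedGammaL_smul_eq hσ
    (moebius (0 : F) t 1 0 (by simpa))
  · rw [det_moebius] at hd
    have : 0 * 0 - t * 1 = -1 * t := by ring
    rw [this, isSquare_mul_iff_of_finite (by simp) h0] at hd
    exact absurd (hd.1 hneg) hsq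
  · refine ⟨g, ?_, ?_⟩
    · rw [Finset.smul_pair, hg, hg, moebius_smul_coe, moebius_smul_infty]
      simp [Finset.pair_comm]
    · rw [Finset.smul_pair, hg, hg, moebius_smul_coe, moebius_smul_coe]
      simp [h0, Finset.pair_comm]

/-- An element of the stabilizer of {∞, 0} sends 1 to k, so k = 1 or k = t', and either way t' is
τ(t) or its inverse. If τ = σ then k is a non-square; this excludes k = 1 and makes t', hence t, a
non-square. -/
theorem crossOrbital_eq_iff (hneg : IsSquare (-1 : F)) {t t' : F} (ht : 1 ≠ t) (h0 : t ≠ 0) :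
    crossOrbital σ hσ t = crossOrbital σ hσ t' ↔
      t' = t ∨ t' = t⁻¹ ∨ ¬ IsSquare t ∧ (t' = σ t ∨ t' = (σ t)⁻¹) := by
  constructor
  · rw [crossOrbital_eq_iff_exists ht]
    rintro ⟨g, h1, h2⟩
    obtain ⟨k, hk0, τ, hτ, hk⟩ := exists_scaling_of_smul_pair_eq hneg g h1
    have hτ0 : τ t ≠ 0 := by simpa using h0
    rw [Finset.smul_pair, Finset.pair_eq_pair_iff'] at h2
    have hcases : (k = 1 ∧ (t' = τ t ∨ t' = (τ t)⁻¹)) ∨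
        (k = t' ∧ (t' = τ t ∨ t' = (τ t)⁻¹)) := by
      rcases hk with hk | hk
      · rw [hk 1 one_ne_zero, hk t h0] at h2
        simp only [map_one, mul_one, OnePoint.coe_eq_coe] at h2
        rcases h2 with ⟨rfl, rfl⟩ | ⟨rfl, h2⟩
        · simp
        · exact Or.inr ⟨rfl, Or.inr (eq_inv_of_mul_eq_one_left h2)⟩
      · rw [hk 1 one_ne_zero, hk t h0] at h2
        simp only [map_one, inv_one, mul_one, OnePoint.coe_eq_coe] at h2
        rcases h2 with ⟨rfl, rfl⟩ | ⟨rfl, h2⟩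
        · simp
        · exact Or.inr ⟨rfl, Or.inl ((mul_inv_eq_one₀ hτ0).1 h2)⟩
    rcases hτ with ⟨hsq, rfl⟩ | ⟨hsq, rfl⟩
    · change (k = 1 ∧ (t' = t ∨ t' = t⁻¹)) ∨ (k = t' ∧ (t' = t ∨ t' = t⁻¹)) at hcases
      tauto
    · rcases hcases with ⟨rfl, -⟩ | ⟨rfl, h⟩
      · exact absurd IsSquare.one hsq
      · refine Or.inr (Or.inr ⟨?_, h⟩)
        rcases h with rfl | rfl
        · rwa [isSquare_ringAut_iff] at hsq
        · rwa [isSquare_inv, isSquare_ringAut_iff] at hsq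
  · rintro (rfl | rfl | ⟨hsq, rfl | rfl⟩)
    · rfl
    · exact (crossOrbital_inv hneg ht h0).symm
    · exact (crossOrbital_involution hneg hsq).symm
    · rw [crossOrbital_inv hneg, crossOrbital_involution hneg hsq]
      · intro h
        exact ht (σ.injective (by rw [map_one, h]))
      · simpa using h0

/-- For t = 0 the two pairs share the point 0; for t ≠ 0 they are disjoint. -/
theorem crossOrbital_zero_ne {t : F} (h0 : t ≠ 0) :
    crossOrbital σ hσ 0 ≠ crossOrbital σ hσ t := by
  intro h
  have h1 := mem_crossOrbital_self (σ := σ) (hσ := hσ) (t := 0) one_ne_zero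
  rw [h] at h1
  obtain ⟨g, g1, g2⟩ := h1
  have m1 : g • ((0 : F) : OnePoint F) ∈ ({∞, ((0 : F) : OnePoint F)} : Finset (OnePoint F)) := by
    rw [← g1]
    exact Finset.smul_mem_smul_finset (by simp [inftyZero])
  have m2 : g • ((0 : F) : OnePoint F) ∈
      ({((1 : F) : OnePoint F), (t : OnePoint F)} : Finset (OnePoint F)) := by
    rw [← g2]
    exact Finset.smul_mem_smul_finset (by simp [finitePair])
  rw [Finset.mem_insert, Finset.mem_singleton] at m1 m2
  rcases m1 with m1 | m1 <;> rw [m1] at m2 <;> simp [Ne.symm h0] at m2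

theorem crossOrbital_ne_diagonal {t : F} (ht : 1 ≠ t) :
    crossOrbital σ hσ t ≠ Set.diagonal _ := by
  intro h
  have h1 := mem_crossOrbital_self (σ := σ) (hσ := hσ) ht
  rw [h] at h1
  have h2 : (inftyZero F).1 = (finitePair ht).1 := congrArg _ h1
  have h3 : (∞ : OnePoint F) ∈ (finitePair ht).1 := by
    rw [← h2]
    simp [inftyZero]
  simp [finitePair] at h3

instance : MulAction.IsPretransitive (twistedGammaL σ hσ) (Set.powersetCard (OnePoint F) 2) := by
  have key : ∀ s : Set.powersetCard (OnePoint F) 2, ∃ g : twistedGammaL σ hσ,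
      g • s = inftyZero F := by
    intro s
    obtain ⟨x, y, hxy, hs⟩ := Finset.card_eq_two.1 s.2
    obtain ⟨h, hx, hy⟩ := exists_smul_eq_infty_zero hxy
    obtain ⟨g, ⟨-, hg⟩ | ⟨-, hg⟩⟩ := exists_twistedGammaL_smul_eq hσ h
    · refine ⟨g, Subtype.ext ?_⟩
      change g • s.1 = (inftyZero F).1
      rw [hs, Finset.smul_pair, hg, hg, hx, hy]
      rfl
    · refine ⟨g, Subtype.ext ?_⟩
      change g • s.1 = (inftyZero F).1
      rw [hs, Finset.smul_pair, hg, hg, hx, hy]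
      simp [inftyZero]
  refine ⟨fun s s' => ?_⟩
  obtain ⟨g, hg⟩ := key s
  obtain ⟨g', hg'⟩ := key s'
  exact ⟨g'⁻¹ * g, by rw [mul_smul, hg, ← hg', inv_smul_smul]⟩

theorem orbitals_eq_insert_diagonal (hσ : orderOf σ = 2) :
    orbitals (twistedGammaL σ hσ) (Set.powersetCard (OnePoint F) 2) =
      insert (Set.diagonal _) (insert (crossOrbital σ hσ 0)
        (crossOrbital σ hσ '' {t | t ≠ 0 ∧ 1 ≠ t})) := by
  ext R
  constructor
  · intro hR
    obtain ⟨⟨s, s'⟩, hss⟩ := Setoid.nonempty_of_mem_partition isPartition_orbitals hR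
    have hR' := eq_orbit_of_mem_orbitals hR hss
    rcases eq_or_exists_mem_crossOrbital hσ s s' with rfl | ⟨t, ht, hm⟩
    · exact Or.inl (hR'.trans (orbit_diagonal_eq s))
    · have : R = crossOrbital σ hσ t :=
        hR'.trans (eq_orbit_of_mem_orbitals (crossOrbital_mem_orbitals ht) hm).symm
      by_cases h0 : t = 0
      · exact Or.inr (Or.inl (by rw [this, h0]))
      · exact Or.inr (Or.inr ⟨t, ⟨h0, ht⟩, this.symm⟩)
  · rintro (rfl | rfl | ⟨t, ⟨-, ht⟩, rfl⟩)
    · exact ⟨(inftyZero F, inftyZero F), orbit_diagonal_eq _⟩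
    · exact crossOrbital_mem_orbitals one_ne_zero
    · exact crossOrbital_mem_orbitals ht

end CrossOrbitals

/-! ### The number of orbitals, and asymmetry for r > 3 -/

section OrbitalCount

open scoped Pointwise

theorem Finset.card_image_mul_of_card_fiber {α β : Type*} [DecidableEq β] (s : Finset α)
    (φ : α → β) {n : ℕ} (h : ∀ a ∈ s, (s.filter fun b => φ b = φ a).card = n) :
    (s.image φ).card * n = s.card := by
  rw [Finset.card_eq_sum_card_image φ s, Finset.sum_const_nat]
  intro b hb
  obtain ⟨a, ha, rfl⟩ := Finset.mem_image.1 hb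
  exact h a ha

variable {F : Type*} [Field F] [Fintype F] [DecidableEq F] {σ : RingAut F} {hσ : orderOf σ = 2}
  {r : ℕ}

/-- The fibre of t is {t, 1/t, σ(t), 1/σ(t)}. Its four members differ: a coincidence would put t
among ±1, or give t^r = t or t^r = 1/t, and each makes t a square. -/
theorem card_crossOrbital_nonsquare (hr : r * r = Fintype.card F) (hodd : Odd r)
    (hpow : ∀ x, σ x = x ^ r) [DecidableEq (Set (Set.powersetCard (OnePoint F) 2 ×
      Set.powersetCard (OnePoint F) 2))] :
    ((Finset.univ.filter fun t : F => ¬ IsSquare t).image (crossOrbital σ hσ)).card * 4 =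
      (Finset.univ.filter fun t : F => ¬ IsSquare t).card := by
  have hneg := isSquare_neg_one_of_odd_sqrt_card hr hodd
  apply Finset.card_image_mul_of_card_fiber
  intro t ht
  simp only [Finset.mem_filter, Finset.mem_univ, true_and] at ht
  have h0 : t ≠ 0 := by
    rintro rfl
    exact ht IsSquare.zero
  have h1 : 1 ≠ t := by
    rintro rfl
    exact ht IsSquare.one
  have hm1 : t ≠ -1 := by
    rintro rfl
    exact ht hneg
  have hinv : t ≠ t⁻¹ := by
    intro h
    have h2 : t * t = 1 := by
      nth_rw 2 [h]
      exact mul_inv_cancel₀ h0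
    rcases mul_self_eq_one_iff.1 h2 with h | h
    · exact h1 h.symm
    · exact hm1 h
  have hσt : t ≠ σ t := fun h =>
    ht (isSquare_of_pow_sub_one_eq_one hr hodd h0 ((hpow t).symm.trans h.symm))
  have hσi : t ≠ (σ t)⁻¹ := fun h =>
    ht (isSquare_of_pow_eq_inv hr hodd h0 ((hpow t).symm.trans (inv_eq_iff_eq_inv.1 h.symm)))
  have hσinv : σ t ≠ (σ t)⁻¹ := fun h => hinv (σ.injective (by rw [map_inv₀]; exact h))
  have : (Finset.univ.filter fun t : F => ¬ IsSquare t).filter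
      (fun b => crossOrbital σ hσ b = crossOrbital σ hσ t) = {t, t⁻¹, σ t, (σ t)⁻¹} := by
    ext b
    simp only [Finset.mem_filter, Finset.mem_univ, true_and, Finset.mem_insert,
      Finset.mem_singleton]
    rw [eq_comm (a := crossOrbital σ hσ b), crossOrbital_eq_iff hneg h1 h0]
    constructor
    · tauto
    · intro h
      refine ⟨?_, by tauto⟩
      rcases h with rfl | rfl | rfl | rfl
      · exact ht
      · rwa [isSquare_inv]
      · rwa [isSquare_ringAut_iff]
      · rwa [isSquare_inv, isSquare_ringAut_iff]
  rw [this]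
  rw [Finset.card_insert_of_notMem, Finset.card_insert_of_notMem, Finset.card_pair hσinv]
  · simp only [Finset.mem_insert, Finset.mem_singleton, not_or]
    refine ⟨fun h => hσi ?_, fun h => hσt (inv_injective h)⟩
    rw [← h, inv_inv]
  · simp only [Finset.mem_insert, Finset.mem_singleton, not_or]
    exact ⟨hinv, hσt, hσi⟩

/-- For squares σ gives no identification, so the fibre is {t, 1/t}; -1 is left out because it is
its own inverse. -/
theorem card_crossOrbital_square (hneg : IsSquare (-1 : F)) [DecidableEq (Set (Set.powersetCard
      (OnePoint F) 2 × Set.powersetCard (OnePoint F) 2))] :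
    ((Finset.univ.filter fun t : F => IsSquare t ∧ t ≠ 0 ∧ t ≠ 1 ∧ t ≠ -1).image
        (crossOrbital σ hσ)).card * 2 =
      (Finset.univ.filter fun t : F => IsSquare t ∧ t ≠ 0 ∧ t ≠ 1 ∧ t ≠ -1).card := by
  apply Finset.card_image_mul_of_card_fiber
  intro t ht
  simp only [Finset.mem_filter, Finset.mem_univ, true_and] at ht
  obtain ⟨ht, h0, h1, hm1⟩ := ht
  have hinv : t ≠ t⁻¹ := by
    intro h
    have h2 : t * t = 1 := by
      nth_rw 2 [h]
      exact mul_inv_cancel₀ h0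
    rcases mul_self_eq_one_iff.1 h2 with h | h
    · exact h1 h
    · exact hm1 h
  have : (Finset.univ.filter fun t : F => IsSquare t ∧ t ≠ 0 ∧ t ≠ 1 ∧ t ≠ -1).filter
      (fun b => crossOrbital σ hσ b = crossOrbital σ hσ t) = {t, t⁻¹} := by
    ext b
    simp only [Finset.mem_filter, Finset.mem_univ, true_and, Finset.mem_insert,
      Finset.mem_singleton]
    rw [eq_comm (a := crossOrbital σ hσ b), crossOrbital_eq_iff hneg h1.symm h0]
    constructor
    · tauto
    · intro h
      refine ⟨?_, by tauto⟩
      rcases h with rfl | rfl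
      · exact ⟨ht, h0, h1, hm1⟩
      · refine ⟨by rwa [isSquare_inv], inv_ne_zero h0, inv_ne_one.2 h1, fun h => hm1 ?_⟩
        rw [← inv_inv t, h, inv_neg, inv_one]
  rw [this, Finset.card_pair hinv]

theorem eight_mul_ncard_orbitals (hr : r * r = Fintype.card F) (hodd : Odd r)
    (hpow : ∀ x, σ x = x ^ r) :
    8 * (orbitals (twistedGammaL σ hσ) (Set.powersetCard (OnePoint F) 2)).ncard =
      3 * Fintype.card F + 13 := by
  classical
  have hneg := isSquare_neg_one_of_odd_sqrt_card hr hodd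
  have hF := ringChar_ne_two_of_odd_sqrt_card hr hodd
  have hne : (-1 : F) ≠ 1 := Ring.neg_one_ne_one_of_char_ne_two hF
  set S := Finset.univ.filter fun t : F => IsSquare t ∧ t ≠ 0 ∧ t ≠ 1 ∧ t ≠ -1 with hS
  set N := Finset.univ.filter fun t : F => ¬ IsSquare t with hN
  have hset : orbitals (twistedGammaL σ hσ) (Set.powersetCard (OnePoint F) 2) =
      ((insert (Set.diagonal _) (insert (crossOrbital σ hσ 0) (insert (crossOrbital σ hσ (-1))
        (S.image (crossOrbital σ hσ) ∪ N.image (crossOrbital σ hσ)))) : Finset _) : Set _) := by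
    rw [orbitals_eq_insert_diagonal hσ]
    push_cast
    congr 2
    have : {t : F | t ≠ 0 ∧ 1 ≠ t} = insert (-1) ((S : Set F) ∪ N) := by
      ext t
      simp only [Set.mem_ofPred_eq, Set.mem_insert_iff, Set.mem_union, Finset.mem_coe, hS, hN,
        Finset.mem_filter, Finset.mem_univ, true_and]
      constructor
      · rintro ⟨h0, h1⟩
        have := h1.symm
        tauto
      · rintro (rfl | ⟨-, h0, h1, -⟩ | h)
        · exact ⟨by simp, hne.symm⟩
        · exact ⟨h0, h1.symm⟩
        · constructor
          · rintro rfl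
            exact h IsSquare.zero
          · rintro rfl
            exact h IsSquare.one
    rw [this, Set.image_insert_eq, Set.image_union]
  have hSmem : ∀ t ∈ S, IsSquare t ∧ t ≠ 0 ∧ t ≠ 1 ∧ t ≠ -1 := fun t ht => by simpa [hS] using ht
  have hNmem : ∀ t ∈ N, ¬ IsSquare t ∧ t ≠ 0 ∧ t ≠ 1 := by
    intro t ht
    have ht' : ¬ IsSquare t := by simpa [hN] using ht
    refine ⟨ht', ?_, ?_⟩
    · rintro rfl
      exact ht' IsSquare.zero
    · rintro rfl
      exact ht' IsSquare.one
  have hSN : Disjoint (S.image (crossOrbital σ hσ)) (N.image (crossOrbital σ hσ)) := by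
    rw [Finset.disjoint_left]
    intro R hR hR'
    obtain ⟨t, ht, rfl⟩ := Finset.mem_image.1 hR
    obtain ⟨u, hu, hut⟩ := Finset.mem_image.1 hR'
    obtain ⟨ht, h0, h1, -⟩ := hSmem t ht
    rcases (crossOrbital_eq_iff hneg h1.symm h0).1 hut.symm with rfl | rfl | h
    · exact (hNmem _ hu).1 ht
    · exact (hNmem _ hu).1 (isSquare_inv.2 ht)
    · exact h.1 ht
  have hm1 : crossOrbital σ hσ (-1) ∉
      S.image (crossOrbital σ hσ) ∪ N.image (crossOrbital σ hσ) := by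
    rw [Finset.mem_union, Finset.mem_image, Finset.mem_image]
    rintro (⟨u, hu, hut⟩ | ⟨u, hu, hut⟩) <;>
      rcases (crossOrbital_eq_iff hneg hne.symm (by simp)).1 hut.symm with rfl | rfl | h
    · exact (hSmem _ hu).2.2.2 rfl
    · exact (hSmem _ hu).2.2.2 (by rw [inv_neg, inv_one])
    · exact h.1 hneg
    · exact (hNmem _ hu).1 hneg
    · exact (hNmem _ hu).1 (isSquare_inv.2 hneg)
    · exact h.1 hneg
  have h0 : crossOrbital σ hσ 0 ∉ insert (crossOrbital σ hσ (-1))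
      (S.image (crossOrbital σ hσ) ∪ N.image (crossOrbital σ hσ)) := by
    rw [Finset.mem_insert, Finset.mem_union, Finset.mem_image, Finset.mem_image]
    rintro (h | ⟨u, hu, h⟩ | ⟨u, hu, h⟩)
    · exact crossOrbital_zero_ne (by simp) h
    · exact crossOrbital_zero_ne (hSmem u hu).2.1 h.symm
    · exact crossOrbital_zero_ne (hNmem u hu).2.1 h.symm
  have hd : Set.diagonal _ ∉ insert (crossOrbital σ hσ 0) (insert (crossOrbital σ hσ (-1))
      (S.image (crossOrbital σ hσ) ∪ N.image (crossOrbital σ hσ))) := by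
    rw [Finset.mem_insert, Finset.mem_insert, Finset.mem_union, Finset.mem_image, Finset.mem_image]
    rintro (h | h | ⟨u, hu, h⟩ | ⟨u, hu, h⟩)
    · exact crossOrbital_ne_diagonal one_ne_zero h.symm
    · exact crossOrbital_ne_diagonal hne.symm h.symm
    · exact crossOrbital_ne_diagonal (hSmem u hu).2.2.1.symm h
    · exact crossOrbital_ne_diagonal (hNmem u hu).2.2.symm h
  rw [hset, Set.ncard_coe_finset, Finset.card_insert_of_notMem hd, Finset.card_insert_of_notMem h0,
    Finset.card_insert_of_notMem hm1, Finset.card_union_of_disjoint hSN]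
  have c1 := card_crossOrbital_nonsquare (hσ := hσ) hr hodd hpow
  have c2 := card_crossOrbital_square (σ := σ) (hσ := hσ) hneg
  obtain ⟨c3, c4⟩ := card_nonzero_squares hF
  rw [← hN] at c1 c4
  rw [← hS] at c2
  -- The nonzero squares are `S` together with 1 and -1, so `S` has (q-5)/2 elements.
  have c5 : (Finset.univ.filter fun t : F => t ≠ 0 ∧ IsSquare t).card = S.card + 1 + 1 := by
    rw [← Finset.card_insert_of_notMem (a := (-1 : F)) (s := S) (by simp [hS]),
      ← Finset.card_insert_of_notMem (a := (1 : F)) (by simp [hS, hne.symm])]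
    congr 1
    ext t
    simp only [hS, Finset.mem_filter, Finset.mem_univ, true_and, Finset.mem_insert]
    constructor
    · tauto
    · rintro (rfl | rfl | h)
      · exact ⟨one_ne_zero, IsSquare.one⟩
      · exact ⟨by simp, hneg⟩
      · exact ⟨h.2.1, h.1⟩
  omega

theorem isAssociationScheme_orbitals_twistedGammaL (hr : r * r = Fintype.card F) (hodd : Odd r)
    (hpow : ∀ x, σ x = x ^ r) {d : ℕ} (hd : 8 * d = 3 * Fintype.card F + 5) :
    IsAssociationScheme
      (orbitals (twistedGammaL σ hσ) (Set.powersetCard (OnePoint F) 2)) d := by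
  have := eight_mul_ncard_orbitals (hσ := hσ) hr hodd hpow
  refine isAssociationScheme_orbitals ?_ (by omega)
  have : Nontrivial (Set.powersetCard (OnePoint F) 2) := by
    refine ⟨inftyZero F, finitePair (zero_ne_one (α := F)), fun h => ?_⟩
    have h2 : (inftyZero F).1 = (finitePair (zero_ne_one (α := F))).1 := congrArg _ h
    have h3 : (∞ : OnePoint F) ∈ (finitePair (zero_ne_one (α := F))).1 := by
      rw [← h2]
      simp [inftyZero]
    simp [finitePair] at h3
  exact Finite.one_lt_card

theorem not_isSymmetricFamily_orbitals_twistedGammaL (hr : r * r = Fintype.card F)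
    (hodd : Odd r) (hpow : ∀ x, σ x = x ^ r) (h3 : 3 < r) : ¬ IsSymmetricFamily
      (orbitals (twistedGammaL σ hσ) (Set.powersetCard (OnePoint F) 2)) := by
  intro hsymm
  have hneg := isSquare_neg_one_of_odd_sqrt_card hr hodd
  have h2 : (2 : F) ≠ 0 := Ring.two_ne_zero (ringChar_ne_two_of_odd_sqrt_card hr hodd)
  have h4 : (4 : F) ≠ 0 := by
    rw [show (4 : F) = 2 * 2 by norm_num]
    exact mul_ne_zero h2 h2
  obtain ⟨w, hw, hw1, hw2⟩ := exists_nonsquare_of_three_lt hr hodd h3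
  have hw0 : w ≠ 0 := by
    rintro rfl
    exact hw IsSquare.zero
  have hw3 : w ^ r ≠ w := fun h => hw (isSquare_of_pow_sub_one_eq_one hr hodd hw0 h)
  have hw4 : w ^ r ≠ w⁻¹ := fun h => hw (isSquare_of_pow_eq_inv hr hodd hw0 h)
  rw [← hpow] at hw1 hw2 hw3 hw4
  have hp : 1 + w ≠ 0 := by
    intro h
    rw [← eq_neg_of_add_eq_zero_right h] at hneg
    exact hw hneg
  have hm : 1 - w ≠ 0 := by
    intro h
    rw [sub_eq_zero] at h
    exact hw (h ▸ IsSquare.one)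
  have hσp : 1 + σ w ≠ 0 := by
    intro h
    exact hp (σ.injective (by rw [map_add, map_one, map_zero, h]))
  have hσm : 1 - σ w ≠ 0 := by
    intro h
    exact hm (σ.injective (by rw [map_sub, map_one, map_zero, h]))
  -- This makes t a square while 1 - t = 4w/(1+w)² lies in the non-square class of w.
  let t : F := ((1 - w) / (1 + w)) ^ 2
  have ht0 : t ≠ 0 := pow_ne_zero _ (div_ne_zero hm hp)
  have htsq : IsSquare t := IsSquare.sq _
  have h1t : 1 - t = w * (2 / (1 + w)) ^ 2 := by
    simp only [t]
    field_simp
    ring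
  have h1tsq : ¬ IsSquare (1 - t) := by
    rw [h1t, isSquare_mul_iff_of_finite hw0 (pow_ne_zero _ (div_ne_zero h2 hp))]
    simp only [hw, IsSquare.sq, iff_true, not_false_eq_true]
  have ht1 : 1 ≠ t := by
    intro h
    rw [← h, sub_self] at h1tsq
    exact h1tsq IsSquare.zero
  have hσt : σ t = ((1 - σ w) / (1 + σ w)) ^ 2 := by simp [t]
  have hne1 : σ t ≠ t := by
    rw [hσt]
    intro h
    -- As a difference of two squares, σ(t) = t factors into σ(w) = w or σ(w) = 1/w; below, σ(t) =
    -- 1/t likewise yields σ(w) = -w or σ(w) = -1/w. All four are excluded for w.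
    simp only [t] at h
    have h5 : (4 : F) * ((σ w - w) * (σ w * w - 1)) = 0 := by
      field_simp at h
      linear_combination h
    simp only [mul_eq_zero, h4, false_or] at h5
    rcases h5 with h5 | h5
    · exact hw3 (sub_eq_zero.1 h5)
    · exact hw4 (eq_inv_of_mul_eq_one_left (sub_eq_zero.1 h5))
  have hne2 : σ t ≠ t⁻¹ := by
    rw [hσt]
    intro h
    simp only [t] at h
    have h5 : (4 : F) * ((σ w + w) * (σ w * w + 1)) = 0 := by
      field_simp at h
      linear_combination -h
    simp only [mul_eq_zero, h4, false_or] at h5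
    rcases h5 with h5 | h5
    · exact hw1 (eq_neg_of_add_eq_zero_left h5)
    · refine hw2 ?_
      rw [← inv_neg]
      exact eq_inv_of_mul_eq_one_left (by rw [mul_neg, eq_neg_of_add_eq_zero_left h5, neg_neg])
  have hR := hsymm _ (crossOrbital_mem_orbitals (hσ := hσ) ht1)
  have hmem : (finitePair ht1, inftyZero F) ∈ crossOrbital σ hσ t := by
    have := mem_crossOrbital_self (σ := σ) (hσ := hσ) ht1
    rwa [← hR] at this
  -- The map (x-1)/(x-t) sends 1, t to 0, ∞ and ∞, 0 to 1, 1/t. Its determinant 1 - t is a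
  -- non-square, so the reversed pair has parameter σ(1/t).
  have hdet : (1 : F) * -t - -1 * 1 ≠ 0 := by
    rw [show (1 : F) * -t - -1 * 1 = 1 - t by ring]
    exact sub_ne_zero.2 ht1
  have hsmul1 : moebius 1 (-1) 1 (-t) hdet • (finitePair ht1).1 =
      {∞, ((0 : F) : OnePoint F)} := by
    have h : (1 : F) + -t ≠ 0 := by
      rw [← sub_eq_add_neg]
      exact sub_ne_zero.2 ht1
    simp [finitePair, Finset.smul_pair, moebius_smul_coe, h, Finset.pair_comm]
  have hsmul2 : moebius 1 (-1) 1 (-t) hdet • (inftyZero F).1 =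
      {((1 : F) : OnePoint F), ((t⁻¹ : F) : OnePoint F)} := by
    simp [inftyZero, Finset.smul_pair, moebius_smul_coe, moebius_smul_infty, ht0]
  rcases mem_crossOrbital_of_GL (σ := σ) (hσ := hσ) _ hsmul1 hsmul2 with ⟨hd, -⟩ | ⟨-, hm'⟩
  · rw [det_moebius, show (1 : F) * -t - -1 * 1 = 1 - t by ring] at hd
    exact h1tsq hd
  · have hne3 : 1 ≠ σ t⁻¹ := by
      intro h
      rw [← map_one σ] at h
      exact ht1 (inv_eq_one.1 (σ.injective h).symm).symm
    have heq : crossOrbital σ hσ t = crossOrbital σ hσ (σ t⁻¹) :=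
      (eq_orbit_of_mem_orbitals (crossOrbital_mem_orbitals ht1) hmem).trans
        (eq_orbit_of_mem_orbitals (crossOrbital_mem_orbitals hne3) hm').symm
    rcases (crossOrbital_eq_iff hneg ht1 ht0).1 heq with h | h | h
    · rw [map_inv₀] at h
      exact hne2 (inv_eq_iff_eq_inv.1 h)
    · rw [map_inv₀] at h
      exact hne1 (inv_injective h)
    · exact h.1 htsq

end OrbitalCount

/-! ### Products of invariant adjacency matrices -/

section InvariantMatrices

variable {G X : Type*} [Group G] [MulAction G X]

theorem adjacencyMatrix_smul_smul {R : Set (X × X)} (hR : R ∈ orbitals G X) (g : G) (x y : X) :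
    adjacencyMatrix R (g • x) (g • y) = adjacencyMatrix R x y := by
  classical
  simp only [adjacencyMatrix, Matrix.of_apply]
  exact if_congr (smul_mem_orbital_iff hR g) rfl rfl

/-- Invariance of the product means that one entry per orbital determines it. -/
theorem mul_adjacencyMatrix_smul_smul [Fintype X] {R S : Set (X × X)} (hR : R ∈ orbitals G X)
    (hS : S ∈ orbitals G X) (g : G) (x y : X) :
    (adjacencyMatrix R * adjacencyMatrix S) (g • x) (g • y) =
      (adjacencyMatrix R * adjacencyMatrix S) x y := by
  rw [Matrix.mul_apply, Matrix.mul_apply]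
  refine (Fintype.sum_equiv (MulAction.toPerm g) _ _ fun z => ?_).symm
  rw [MulAction.toPerm_apply, adjacencyMatrix_smul_smul hR, adjacencyMatrix_smul_smul hS]

open Classical in
theorem mul_adjacencyMatrix_apply [Fintype X] {R S : Set (X × X)} (x y : X) (T : Finset X)
    (hT : ∀ z, (x, z) ∈ R ↔ z ∈ T) :
    (adjacencyMatrix R * adjacencyMatrix S) x y = ∑ z ∈ T, adjacencyMatrix S z y := by
  rw [Matrix.mul_apply]
  simp only [adjacencyMatrix, Matrix.of_apply, hT, ite_mul, one_mul, zero_mul]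
  rw [Finset.sum_ite_mem, Finset.univ_inter]

end InvariantMatrices

/-! ### The five orbitals over the field of order nine -/

section FieldOfOrderNine

open scoped Pointwise

variable {F : Type*} [Field F] [Fintype F]

theorem three_eq_zero_of_card_eq_nine (h9 : Fintype.card F = 9) : (3 : F) = 0 := by
  have : CharP F 3 := by
    have : Fact (Nat.Prime 3) := ⟨Nat.prime_three⟩
    exact charP_of_card_eq_prime_pow (f := 2) (by rw [h9]; norm_num)
  exact_mod_cast CharP.cast_eq_zero F 3

theorem pow_eight_eq_one_of_card_eq_nine (h9 : Fintype.card F = 9) {x : F} (hx : x ≠ 0) :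
    x ^ 8 = 1 := by
  have := FiniteField.pow_card_sub_one_eq_one x hx
  rwa [h9] at this

theorem isSquare_iff_of_card_eq_nine (h9 : Fintype.card F = 9) {x : F} (hx : x ≠ 0) :
    IsSquare x ↔ x ^ 4 = 1 := by
  have := FiniteField.isSquare_iff
    (ringChar_ne_two_of_odd_sqrt_card (F := F) (r := 3) (by rw [h9]) (by decide)) hx
  rwa [h9] at this

variable {i : F}

/-- In characteristic 3 the eight linear factors multiply to k⁸ - 1, since (1 ± i)² = ±2i. -/
theorem eq_of_ne_zero_of_card_eq_nine (h9 : Fintype.card F = 9) (hi : i * i = -1) {k : F}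
    (hk : k ≠ 0) : (k = 1 ∨ k = -1) ∨ (k = i ∨ k = -i) ∨ (k = 1 + i ∨ k = -(1 + i)) ∨
      (k = 1 - i ∨ k = -(1 - i)) := by
  have h3 := three_eq_zero_of_card_eq_nine h9
  have h8 := pow_eight_eq_one_of_card_eq_nine h9 hk
  have : ((k - 1) * (k + 1)) * (((k - i) * (k + i)) * (((k - (1 + i)) * (k + (1 + i))) *
      ((k - (1 - i)) * (k + (1 - i))))) = 0 := by
    grind
  simpa only [mul_eq_zero, sub_eq_zero, ← eq_neg_iff_add_eq_zero] using this

variable [DecidableEq F] {σ : RingAut F} {hσ : orderOf σ = 2}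

/-- A nonzero square has t⁴ = 1, so σ(t) = t³ = 1/t and inversion already identifies t with σ(t).
Thus determinants no longer matter when parameters are computed. -/
theorem crossOrbital_involution_of_card_eq_nine (h9 : Fintype.card F = 9)
    (hpow : ∀ x, σ x = x ^ 3) (t : F) : crossOrbital σ hσ (σ t) = crossOrbital σ hσ t := by
  have hneg : IsSquare (-1 : F) :=
    isSquare_neg_one_of_odd_sqrt_card (r := 3) (by rw [h9]) (by decide)
  by_cases h0 : t = 0
  · rw [h0, map_zero]
  by_cases h1 : 1 = t
  · rw [← h1, map_one]
  by_cases hs : IsSquare t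
  · rw [← crossOrbital_inv hneg h1 h0]
    congr 1
    apply eq_inv_of_mul_eq_one_left
    rw [hpow, ← pow_succ, (isSquare_iff_of_card_eq_nine h9 h0).1 hs]
  · exact crossOrbital_involution hneg hs

theorem mem_crossOrbital_of_GL_of_card_eq_nine (h9 : Fintype.card F = 9)
    (hpow : ∀ x, σ x = x ^ 3) (h : GL (Fin 2) F) {s s' : Set.powersetCard (OnePoint F) 2} {t : F}
    (hs : h • s.1 = {∞, ((0 : F) : OnePoint F)})
    (hs' : h • s'.1 = {((1 : F) : OnePoint F), (t : OnePoint F)}) :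
    (s, s') ∈ crossOrbital σ hσ t := by
  rcases mem_crossOrbital_of_GL (σ := σ) (hσ := hσ) h hs hs' with ⟨-, hm⟩ | ⟨-, hm⟩
  · exact hm
  · rwa [crossOrbital_involution_of_card_eq_nine h9 hpow] at hm

/-- The orbital of two pairs of finite points is determined by their cross-ratio. -/
theorem mem_crossOrbital_of_crossRatio (h9 : Fintype.card F = 9) (hpow : ∀ x, σ x = x ^ 3)
    {s s' : Set.powersetCard (OnePoint F) 2} {t : F} (a b c d : F)
    (hs : s.1 = {(a : OnePoint F), (b : OnePoint F)})
    (hs' : s'.1 = {(c : OnePoint F), (d : OnePoint F)})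
    (hab : b - a ≠ 0) (hca : c - a ≠ 0) (hcb : c - b ≠ 0) (hda : d - a ≠ 0)
    (ht : t * ((c - b) * (d - a)) = (c - a) * (d - b)) : (s, s') ∈ crossOrbital σ hσ t := by
  -- The matrix is that of x ↦ (c-a)(x-b) / ((c-b)(x-a)), which sends a, b, c to ∞, 0, 1 and d to
  -- the cross-ratio t.
  have hdet : (c - a) * (-(c - b) * a) - (-(c - a) * b) * (c - b) ≠ 0 := by
    rw [show (c - a) * (-(c - b) * a) - (-(c - a) * b) * (c - b) =
      (c - a) * ((c - b) * (b - a)) by ring]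
    exact mul_ne_zero hca (mul_ne_zero hcb hab)
  refine mem_crossOrbital_of_GL_of_card_eq_nine h9 hpow (moebius _ _ _ _ hdet) ?_ ?_
  · have e1 : (c - b) * a + -(c - b) * a = 0 := by ring
    have e2 : (c - b) * b + -(c - b) * a ≠ 0 := by
      rw [show (c - b) * b + -(c - b) * a = (c - b) * (b - a) by ring]
      exact mul_ne_zero hcb hab
    have e3 : (c - a) * b + -(c - a) * b = 0 := by ring
    rw [hs, Finset.smul_pair, moebius_smul_coe, moebius_smul_coe, if_pos e1, if_neg e2, e3,
      zero_div]
  · have e1 : (c - b) * c + -(c - b) * a = (c - a) * (c - b) := by ring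
    have e2 : (c - b) * d + -(c - b) * a = (c - b) * (d - a) := by ring
    have e3 : (c - a) * c + -(c - a) * b = (c - a) * (c - b) := by ring
    have e4 : (c - a) * d + -(c - a) * b = (c - a) * (d - b) := by ring
    rw [hs', Finset.smul_pair, moebius_smul_coe, moebius_smul_coe, e1, e2, e3, e4,
      if_neg (mul_ne_zero hca hcb), if_neg (mul_ne_zero hcb hda), div_self (mul_ne_zero hca hcb),
      ← ht, mul_div_cancel_right₀ _ (mul_ne_zero hcb hda)]

/-- The exchange map (x-1)/(x-t) turns t into 1/t, and now no condition on its determinant is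
needed. For t = 0 the map x/(x-1) exchanges the pairs. -/
theorem isSymmetricFamily_of_card_eq_nine (h9 : Fintype.card F = 9) (hpow : ∀ x, σ x = x ^ 3) :
    IsSymmetricFamily (orbitals (twistedGammaL σ hσ) (Set.powersetCard (OnePoint F) 2)) := by
  have hneg : IsSquare (-1 : F) :=
    isSquare_neg_one_of_odd_sqrt_card (r := 3) (by rw [h9]) (by decide)
  have key : ∀ t : F, ∀ ht : 1 ≠ t, (finitePair ht, inftyZero F) ∈ crossOrbital σ hσ t →
      Prod.swap ⁻¹' crossOrbital σ hσ t = crossOrbital σ hσ t := by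
    intro t ht hm
    rw [crossOrbital_eq_orbit ht, swap_preimage_orbit, ← crossOrbital_eq_orbit ht]
    exact (eq_orbit_of_mem_orbitals (crossOrbital_mem_orbitals ht) hm).symm
  rw [orbitals_eq_insert_diagonal hσ]
  rintro R (rfl | rfl | ⟨t, ⟨h0, ht⟩, rfl⟩)
  · ext ⟨x, y⟩
    exact eq_comm
  · refine key 0 one_ne_zero (mem_crossOrbital_of_GL_of_card_eq_nine h9 hpow
      (moebius 1 0 1 (-1) (by simp)) ?_ ?_)
    · simp [finitePair, Finset.smul_pair, moebius_smul_coe]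
    · simp [inftyZero, Finset.smul_pair, moebius_smul_coe, moebius_smul_infty]
  · refine key t ht ?_
    rw [← crossOrbital_inv hneg ht h0]
    have h1 : (1 : F) + -t ≠ 0 := by
      rw [← sub_eq_add_neg]
      exact sub_ne_zero.2 ht
    refine mem_crossOrbital_of_GL_of_card_eq_nine h9 hpow
      (moebius 1 (-1) 1 (-t) (by rw [show (1 : F) * -t - -1 * 1 = 1 + -t by ring]; exact h1)) ?_ ?_
    · simp [finitePair, Finset.smul_pair, moebius_smul_coe, h1, Finset.pair_comm]
    · simp [inftyZero, Finset.smul_pair, moebius_smul_coe, moebius_smul_infty, h0]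

/-- The four non-squares ±1 ± i are linked by σ(1+i) = 1-i and 1/(1+i) = -(1-i). -/
theorem crossOrbital_of_not_isSquare_of_card_eq_nine (h9 : Fintype.card F = 9)
    (hpow : ∀ x, σ x = x ^ 3) (hi : i * i = -1) {t : F} (ht : t ≠ 0) (hs : ¬ IsSquare t) :
    crossOrbital σ hσ t = crossOrbital σ hσ (1 + i) := by
  have hneg : IsSquare (-1 : F) := ⟨i, hi.symm⟩
  have h3 := three_eq_zero_of_card_eq_nine h9
  have h10 : (1 : F) ≠ 0 := one_ne_zero
  have h1 : 1 ≠ t := by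
    rintro rfl
    exact hs IsSquare.one
  rw [crossOrbital_eq_iff hneg h1 ht, hpow]
  have hsq : ∀ x : F, x ≠ 0 → x ^ 4 = 1 → t ≠ x := by
    rintro x h0 hx rfl
    exact hs ((isSquare_iff_of_card_eq_nine h9 h0).2 hx)
  have hi0 : i ≠ 0 := by
    rintro rfl
    simp at hi
  rcases eq_of_ne_zero_of_card_eq_nine h9 hi ht with
    (h | h) | (h | h) | (rfl | rfl) | (rfl | rfl)
  · exact absurd h.symm h1
  · exact absurd h (hsq _ (by simp) (by norm_num))
  · exact absurd h (hsq _ hi0 (by grind))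
  · exact absurd h (hsq _ (by simpa using hi0) (by grind))
  · exact Or.inl rfl
  · exact Or.inr (Or.inr ⟨hs, Or.inr (eq_inv_of_mul_eq_one_left (by grind))⟩)
  · exact Or.inr (Or.inr ⟨hs, Or.inl (by grind)⟩)
  · exact Or.inr (Or.inl (eq_inv_of_mul_eq_one_left (by grind)))

/-- The orbitals for the field of order nine. -/
def nineOrbital (σ : RingAut F) (hσ : orderOf σ = 2) (i : F) :
    ℕ → Set (Set.powersetCard (OnePoint F) 2 × Set.powersetCard (OnePoint F) 2)
  | 0 => Set.diagonal _
  | 1 => crossOrbital σ hσ (-1)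
  | 2 => crossOrbital σ hσ i
  | 3 => crossOrbital σ hσ 0
  | _ => crossOrbital σ hσ (1 + i)

theorem crossOrbital_neg_of_mul_self_eq_neg_one (hi : i * i = -1) :
    crossOrbital σ hσ (-i) = crossOrbital σ hσ i := by
  have hneg : IsSquare (-1 : F) := ⟨i, hi.symm⟩
  have h0 : i ≠ 0 := by
    rintro rfl
    simp at hi
  have h1 : (-i) = i⁻¹ := eq_inv_of_mul_eq_one_left (by rw [neg_mul, hi, neg_neg])
  by_cases h : 1 = i
  · rw [h1, ← h, inv_one]
  · rw [h1, crossOrbital_inv hneg h h0]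

theorem nineOrbital_image_eq (h9 : Fintype.card F = 9) (hpow : ∀ x, σ x = x ^ 3)
    (hi : i * i = -1) : nineOrbital σ hσ i '' Set.Iic 4 =
      orbitals (twistedGammaL σ hσ) (Set.powersetCard (OnePoint F) 2) := by
  have h3 := three_eq_zero_of_card_eq_nine h9
  have h10 : (1 : F) ≠ 0 := one_ne_zero
  rw [orbitals_eq_insert_diagonal hσ]
  ext R
  constructor
  · rintro ⟨n, hn, rfl⟩
    have hn' : n ≤ 4 := hn
    interval_cases n
    · exact Or.inl rfl
    · exact Or.inr (Or.inr ⟨-1, ⟨by simp, by grind⟩, rfl⟩)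
    · exact Or.inr (Or.inr ⟨i, ⟨by grind, by grind⟩, rfl⟩)
    · exact Or.inr (Or.inl rfl)
    · exact Or.inr (Or.inr ⟨1 + i, ⟨by grind, by grind⟩, rfl⟩)
  · rintro (rfl | rfl | ⟨t, ⟨h0, ht⟩, rfl⟩)
    · exact ⟨0, by simp, rfl⟩
    · exact ⟨3, by simp, rfl⟩
    · by_cases hs : IsSquare t
      · have h4 := (isSquare_iff_of_card_eq_nine h9 h0).1 hs
        have : (t - 1) * ((t + 1) * ((t - i) * (t + i))) = 0 := by grind
        simp only [mul_eq_zero, sub_eq_zero, ← eq_neg_iff_add_eq_zero] at this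
        rcases this with rfl | rfl | rfl | rfl
        · exact absurd rfl ht
        · exact ⟨1, by simp, rfl⟩
        · exact ⟨2, by simp, rfl⟩
        · exact ⟨2, by simp, (crossOrbital_neg_of_mul_self_eq_neg_one hi).symm⟩
      · exact ⟨4, by simp, (crossOrbital_of_not_isSquare_of_card_eq_nine h9 hpow hi h0 hs).symm⟩

/-- Injectivity comes from counting: the five indices map onto (3·9+13)/8 = 5 orbitals. -/
theorem bijOn_nineOrbital (h9 : Fintype.card F = 9) (hpow : ∀ x, σ x = x ^ 3)
    (hi : i * i = -1) : Set.BijOn (nineOrbital σ hσ i) (Set.Iic 4)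
      (orbitals (twistedGammaL σ hσ) (Set.powersetCard (OnePoint F) 2)) := by
  rw [← nineOrbital_image_eq h9 hpow hi]
  refine Set.InjOn.bijOn_image (Set.injOn_of_ncard_image_eq ?_ (Set.finite_Iic 4))
  rw [nineOrbital_image_eq h9 hpow hi]
  have := eight_mul_ncard_orbitals (σ := σ) (hσ := hσ) (r := 3) (by rw [h9]) (by decide) hpow
  rw [h9] at this
  have hIic : (Set.Iic 4 : Set ℕ).ncard = 5 := by
    rw [← Finset.coe_Iic, Set.ncard_coe_finset, Nat.card_Iic]
  omega

theorem adjacencyMatrix_nineOrbital_apply (h9 : Fintype.card F = 9) (hpow : ∀ x, σ x = x ^ 3)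
    (hi : i * i = -1) {j k : ℕ} (hj : j ≤ 4) (hk : k ≤ 4)
    {x y : Set.powersetCard (OnePoint F) 2} (h : (x, y) ∈ nineOrbital σ hσ i k) :
    adjacencyMatrix (nineOrbital σ hσ i j) x y = if j = k then 1 else 0 := by
  classical
  have hbij := bijOn_nineOrbital (hσ := hσ) h9 hpow hi
  simp only [adjacencyMatrix, Matrix.of_apply]
  refine if_congr ⟨fun h' => hbij.injOn hj hk ?_, fun h' => h' ▸ h⟩ rfl rfl
  exact (eq_orbit_of_mem_orbitals (hbij.mapsTo hj) h').trans
    (eq_orbit_of_mem_orbitals (hbij.mapsTo hk) h).symm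

/-- A choice of the pairs `{c, -c}` with `c ≠ 0`. -/
theorem exists_oppositePair (h9 : Fintype.card F = 9) :
    ∃ z : F → Set.powersetCard (OnePoint F) 2,
      ∀ c, c ≠ 0 → (z c).1 = {(c : OnePoint F), ((-c : F) : OnePoint F)} := by
  have h3 := three_eq_zero_of_card_eq_nine h9
  have h10 : (1 : F) ≠ 0 := one_ne_zero
  have : ∀ c : F, ∃ s : Set.powersetCard (OnePoint F) 2,
      c ≠ 0 → s.1 = {(c : OnePoint F), ((-c : F) : OnePoint F)} := by
    intro c
    by_cases hc : c = 0
    · exact ⟨inftyZero F, fun h => absurd hc h⟩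
    · have : c ≠ -c := by grind
      exact ⟨finitePair this, fun _ => rfl⟩
  choose z hz using this
  exact ⟨z, hz⟩

/-- The maps kτ(x) and k/τ(x) stabilizing {∞, 0} send {1, -1} to {k, -k}; up to sign k is 1, i, 1+i
or 1-i. -/
theorem inftyZero_mem_crossOrbital_neg_one_iff (h9 : Fintype.card F = 9)
    (hpow : ∀ x, σ x = x ^ 3) (hi : i * i = -1) {z : F → Set.powersetCard (OnePoint F) 2}
    (hz : ∀ c, c ≠ 0 → (z c).1 = {(c : OnePoint F), ((-c : F) : OnePoint F)})
    (s : Set.powersetCard (OnePoint F) 2) : (inftyZero F, s) ∈ crossOrbital σ hσ (-1) ↔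
      s = z 1 ∨ s = z i ∨ s = z (1 + i) ∨ s = z (1 - i) := by
  have h3 := three_eq_zero_of_card_eq_nine h9
  have h10 : (1 : F) ≠ 0 := one_ne_zero
  have hneg : IsSquare (-1 : F) := ⟨i, hi.symm⟩
  have hi0 : i ≠ 0 := by grind
  have hp0 : 1 + i ≠ 0 := by grind
  have hm0 : 1 - i ≠ 0 := by grind
  constructor
  · rintro ⟨g, g1, g2⟩
    have g1' : g⁻¹ • ({∞, ((0 : F) : OnePoint F)} : Finset (OnePoint F)) =
        {∞, ((0 : F) : OnePoint F)} := inv_smul_eq_iff.2 g1.symm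
    have g2' : s.1 = g⁻¹ • ({((1 : F) : OnePoint F), ((-1 : F) : OnePoint F)} : Finset _) := by
      rw [← g2, inv_smul_smul]
    have hk : ∃ k : F, k ≠ 0 ∧ s.1 = {(k : OnePoint F), ((-k : F) : OnePoint F)} := by
      obtain ⟨k, hk0, τ, -, hk | hk⟩ := exists_scaling_of_smul_pair_eq hneg g⁻¹ g1' <;>
        refine ⟨k, hk0, ?_⟩ <;>
        rw [g2', Finset.smul_pair, hk _ one_ne_zero, hk _ (by simp)] <;> simp
    obtain ⟨k, hk0, hk⟩ := hk
    have hzk : ∀ c, c ≠ 0 → (k = c ∨ k = -c) → s = z c := by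
      rintro c hc (rfl | rfl)
      · exact Subtype.ext (by rw [hk, hz _ hc])
      · exact Subtype.ext (by rw [hk, hz _ hc, neg_neg, Finset.pair_comm])
    exact (eq_of_ne_zero_of_card_eq_nine h9 hi hk0).imp (hzk _ one_ne_zero)
      (Or.imp (hzk _ hi0) (Or.imp (hzk _ hp0) (hzk _ hm0)))
  · have key : ∀ c, c ≠ 0 → (inftyZero F, z c) ∈ crossOrbital σ hσ (-1) := by
      intro c hc
      refine mem_crossOrbital_of_GL_of_card_eq_nine h9 hpow (moebius 1 0 0 c (by simpa)) ?_ ?_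
      · simp [inftyZero, Finset.smul_pair, moebius_smul_coe, moebius_smul_infty, hc]
      · rw [hz c hc]
        simp [Finset.smul_pair, moebius_smul_coe, hc]
    rintro (rfl | rfl | rfl | rfl)
    · exact key _ one_ne_zero
    · exact key _ hi0
    · exact key _ hp0
    · exact key _ hm0

theorem mul_adjacencyMatrix_nineOrbital_apply (h9 : Fintype.card F = 9)
    (hpow : ∀ x, σ x = x ^ 3) (hi : i * i = -1) {z : F → Set.powersetCard (OnePoint F) 2}
    (hz : ∀ c, c ≠ 0 → (z c).1 = {(c : OnePoint F), ((-c : F) : OnePoint F)})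
    [Fintype (Set.powersetCard (OnePoint F) 2)]
    (S : Set (Set.powersetCard (OnePoint F) 2 × Set.powersetCard (OnePoint F) 2))
    (y : Set.powersetCard (OnePoint F) 2) :
    (adjacencyMatrix (nineOrbital σ hσ i 1) * adjacencyMatrix S) (inftyZero F) y =
      adjacencyMatrix S (z 1) y + adjacencyMatrix S (z i) y + adjacencyMatrix S (z (1 + i)) y +
        adjacencyMatrix S (z (1 - i)) y := by
  classical
  have h3 := three_eq_zero_of_card_eq_nine h9
  have h10 : (1 : F) ≠ 0 := one_ne_zero
  have hi0 : i ≠ 0 := by grind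
  have hp0 : 1 + i ≠ 0 := by grind
  have hm0 : 1 - i ≠ 0 := by grind
  -- The pair {a, -a} determines a², which separates the four neighbours.
  have hinj : ∀ a b, a ≠ 0 → b ≠ 0 → a * a ≠ b * b → z a ≠ z b := by
    intro a b ha hb hab h
    have h1 := congrArg Subtype.val h
    rw [hz a ha, hz b hb, Finset.pair_eq_pair_iff'] at h1
    simp only [OnePoint.coe_eq_coe] at h1
    grind
  rw [mul_adjacencyMatrix_apply (T := {z 1, z i, z (1 + i), z (1 - i)})]
  · rw [Finset.sum_insert, Finset.sum_insert, Finset.sum_insert, Finset.sum_singleton]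
    · ring
    · rw [Finset.mem_singleton]
      exact hinj _ _ hp0 hm0 (by grind)
    · rw [Finset.mem_insert, Finset.mem_singleton, not_or]
      exact ⟨hinj _ _ hi0 hp0 (by grind), hinj _ _ hi0 hm0 (by grind)⟩
    · rw [Finset.mem_insert, Finset.mem_insert, Finset.mem_singleton, not_or, not_or]
      exact ⟨hinj _ _ one_ne_zero hi0 (by grind), hinj _ _ one_ne_zero hp0 (by grind),
        hinj _ _ one_ne_zero hm0 (by grind)⟩
  · intro s
    simp only [Finset.mem_insert, Finset.mem_singleton]
    exact inftyZero_mem_crossOrbital_neg_one_iff h9 hpow hi hz s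

end FieldOfOrderNine

/-! ### The three-term recurrence for q = 9 -/

section PPolynomialNine

variable {F : Type*} [Field F] [Fintype F] [DecidableEq F] {σ : RingAut F} {hσ : orderOf σ = 2}
  {i : F}

/-- The products of adjacency matrices are determined by the relations between a set `y` and the
four neighbours of `{∞, 0}`. -/
theorem mul_adjacencyMatrix_nineOrbital_eq (h9 : Fintype.card F = 9) (hpow : ∀ x, σ x = x ^ 3)
    (hi : i * i = -1) {z : F → Set.powersetCard (OnePoint F) 2}
    (hz : ∀ c, c ≠ 0 → (z c).1 = {(c : OnePoint F), ((-c : F) : OnePoint F)})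
    [Fintype (Set.powersetCard (OnePoint F) 2)] {k m₁ m₂ m₃ m₄ : ℕ} (hk : k ≤ 4) (hm₁ : m₁ ≤ 4)
    (hm₂ : m₂ ≤ 4) (hm₃ : m₃ ≤ 4) (hm₄ : m₄ ≤ 4) {y₀ : Set.powersetCard (OnePoint F) 2}
    (h₀ : (inftyZero F, y₀) ∈ nineOrbital σ hσ i k) (h₁ : (z 1, y₀) ∈ nineOrbital σ hσ i m₁)
    (h₂ : (z i, y₀) ∈ nineOrbital σ hσ i m₂) (h₃ : (z (1 + i), y₀) ∈ nineOrbital σ hσ i m₃)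
    (h₄ : (z (1 - i), y₀) ∈ nineOrbital σ hσ i m₄) {x y : Set.powersetCard (OnePoint F) 2}
    (h : (x, y) ∈ nineOrbital σ hσ i k) {j : ℕ} (hj : j ≤ 4) :
    (adjacencyMatrix (nineOrbital σ hσ i 1) * adjacencyMatrix (nineOrbital σ hσ i j)) x y =
      (if j = m₁ then 1 else 0) + (if j = m₂ then 1 else 0) + (if j = m₃ then 1 else 0) +
        (if j = m₄ then 1 else 0) := by
  have hbij := bijOn_nineOrbital (hσ := hσ) h9 hpow hi
  rw [eq_orbit_of_mem_orbitals (hbij.mapsTo hk) h₀] at h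
  obtain ⟨g, hg⟩ := h
  obtain ⟨rfl, rfl⟩ := Prod.ext_iff.1 hg
  refine (mul_adjacencyMatrix_smul_smul (hbij.mapsTo (by simp)) (hbij.mapsTo hj) g _ _).trans ?_
  rw [mul_adjacencyMatrix_nineOrbital_apply h9 hpow hi hz,
    adjacencyMatrix_nineOrbital_apply h9 hpow hi hj hm₁ h₁,
    adjacencyMatrix_nineOrbital_apply h9 hpow hi hj hm₂ h₂,
    adjacencyMatrix_nineOrbital_apply h9 hpow hi hj hm₃ h₃,
    adjacencyMatrix_nineOrbital_apply h9 hpow hi hj hm₄ h₄]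

/-- The relations between the neighbours of `{∞, 0}` and representatives of the orbitals. -/
theorem exists_nineOrbital_representatives (h9 : Fintype.card F = 9) (hpow : ∀ x, σ x = x ^ 3)
    (hi : i * i = -1) {z : F → Set.powersetCard (OnePoint F) 2}
    (hz : ∀ c, c ≠ 0 → (z c).1 = {(c : OnePoint F), ((-c : F) : OnePoint F)}) :
    (∃ y, (inftyZero F, y) ∈ nineOrbital σ hσ i 0 ∧ (z 1, y) ∈ nineOrbital σ hσ i 1 ∧
      (z i, y) ∈ nineOrbital σ hσ i 1 ∧ (z (1 + i), y) ∈ nineOrbital σ hσ i 1 ∧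
      (z (1 - i), y) ∈ nineOrbital σ hσ i 1) ∧
    (∃ y, (inftyZero F, y) ∈ nineOrbital σ hσ i 1 ∧ (z 1, y) ∈ nineOrbital σ hσ i 0 ∧
      (z i, y) ∈ nineOrbital σ hσ i 1 ∧ (z (1 + i), y) ∈ nineOrbital σ hσ i 2 ∧
      (z (1 - i), y) ∈ nineOrbital σ hσ i 2) ∧
    (∃ y, (inftyZero F, y) ∈ nineOrbital σ hσ i 2 ∧ (z 1, y) ∈ nineOrbital σ hσ i 3 ∧
      (z i, y) ∈ nineOrbital σ hσ i 3 ∧ (z (1 + i), y) ∈ nineOrbital σ hσ i 2 ∧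
      (z (1 - i), y) ∈ nineOrbital σ hσ i 1) ∧
    (∃ y, (inftyZero F, y) ∈ nineOrbital σ hσ i 3 ∧ (z 1, y) ∈ nineOrbital σ hσ i 3 ∧
      (z i, y) ∈ nineOrbital σ hσ i 2 ∧ (z (1 + i), y) ∈ nineOrbital σ hσ i 4 ∧
      (z (1 - i), y) ∈ nineOrbital σ hσ i 4) ∧
    (∃ y, (inftyZero F, y) ∈ nineOrbital σ hσ i 4 ∧ (z 1, y) ∈ nineOrbital σ hσ i 3 ∧
      (z i, y) ∈ nineOrbital σ hσ i 4 ∧ (z (1 + i), y) ∈ nineOrbital σ hσ i 3 ∧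
      (z (1 - i), y) ∈ nineOrbital σ hσ i 4) := by
  have h3 := three_eq_zero_of_card_eq_nine h9
  have h10 : (1 : F) ≠ 0 := one_ne_zero
  have hi0 : i ≠ 0 := by grind
  have hp0 : 1 + i ≠ 0 := by grind
  have hm0 : 1 - i ≠ 0 := by grind
  have hne1 : (1 : F) ≠ -1 := by grind
  have hne2 : 1 ≠ i := by grind
  have hne4 : 1 ≠ 1 + i := by grind
  -- The reversed order serves when z c meets y: the common point then takes the places b = d, a
  -- coincidence allowed in `mem_crossOrbital_of_crossRatio`, and t = 0.
  have hz' : ∀ c, c ≠ 0 → (z c).1 = {((-c : F) : OnePoint F), (c : OnePoint F)} :=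
    fun c hc => (hz c hc).trans (Finset.pair_comm _ _)
  -- Non-squares are recognized by t⁴ = -1, so any such cross-ratio stands for 1 + i.
  have m4 : ∀ t : F, t ^ 4 = -1 → crossOrbital σ hσ t = crossOrbital σ hσ (1 + i) := by
    intro t ht
    have h0 : t ≠ 0 := by grind
    refine crossOrbital_of_not_isSquare_of_card_eq_nine h9 hpow hi h0 ?_
    rw [isSquare_iff_of_card_eq_nine h9 h0, ht]
    exact hne1.symm
  have mneg : crossOrbital σ hσ (-i) = crossOrbital σ hσ i :=
    crossOrbital_neg_of_mul_self_eq_neg_one hi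
  refine ⟨⟨inftyZero F, ?_⟩, ⟨finitePair hne1, ?_⟩, ⟨finitePair hne2, ?_⟩,
    ⟨finitePair (one_ne_zero (α := F)), ?_⟩, ⟨finitePair hne4, ?_⟩⟩
  · have hsymm : ∀ s, (inftyZero F, s) ∈ crossOrbital σ hσ (-1) →
        (s, inftyZero F) ∈ crossOrbital σ hσ (-1) := by
      intro s hs
      rwa [← isSymmetricFamily_of_card_eq_nine h9 hpow _ (crossOrbital_mem_orbitals hne1)] at hs
    have hN := inftyZero_mem_crossOrbital_neg_one_iff (hσ := hσ) h9 hpow hi hz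
    exact ⟨rfl, hsymm _ ((hN _).2 (by simp)), hsymm _ ((hN _).2 (by simp)),
      hsymm _ ((hN _).2 (by simp)), hsymm _ ((hN _).2 (by simp))⟩
  · refine ⟨mem_crossOrbital_self hne1, Subtype.ext (hz 1 one_ne_zero), ?_, ?_, ?_⟩
    · refine mem_crossOrbital_of_crossRatio h9 hpow _ _ 1 (-1) (hz i hi0) rfl ?_ ?_ ?_ ?_ ?_
        <;> grind
    · refine mem_crossOrbital_of_crossRatio h9 hpow _ _ 1 (-1) (hz _ hp0) rfl ?_ ?_ ?_ ?_ ?_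
        <;> grind
    · change _ ∈ crossOrbital σ hσ i
      rw [← mneg]
      refine mem_crossOrbital_of_crossRatio h9 hpow _ _ 1 (-1) (hz _ hm0) rfl ?_ ?_ ?_ ?_ ?_
        <;> grind
  · refine ⟨mem_crossOrbital_self hne2, ?_, ?_, ?_, ?_⟩
    · refine mem_crossOrbital_of_crossRatio h9 hpow _ _ i 1 (hz' _ one_ne_zero)
        (Finset.pair_comm _ _) ?_ ?_ ?_ ?_ ?_ <;> grind
    · refine mem_crossOrbital_of_crossRatio h9 hpow _ _ 1 i (hz' _ hi0) rfl ?_ ?_ ?_ ?_ ?_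
        <;> grind
    · change _ ∈ crossOrbital σ hσ i
      rw [← mneg]
      refine mem_crossOrbital_of_crossRatio h9 hpow _ _ 1 i (hz _ hp0) rfl ?_ ?_ ?_ ?_ ?_
        <;> grind
    · refine mem_crossOrbital_of_crossRatio h9 hpow _ _ 1 i (hz _ hm0) rfl ?_ ?_ ?_ ?_ ?_
        <;> grind
  · refine ⟨mem_crossOrbital_self one_ne_zero, ?_, ?_, ?_, ?_⟩
    · refine mem_crossOrbital_of_crossRatio h9 hpow _ _ 0 1 (hz' _ one_ne_zero)
        (Finset.pair_comm _ _) ?_ ?_ ?_ ?_ ?_ <;> grind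
    · refine mem_crossOrbital_of_crossRatio h9 hpow _ _ 1 0 (hz _ hi0) rfl ?_ ?_ ?_ ?_ ?_
        <;> grind
    · change _ ∈ crossOrbital σ hσ (1 + i)
      rw [← m4 (i - 1) (by grind)]
      refine mem_crossOrbital_of_crossRatio h9 hpow _ _ 1 0 (hz _ hp0) rfl ?_ ?_ ?_ ?_ ?_
        <;> grind
    · change _ ∈ crossOrbital σ hσ (1 + i)
      rw [← m4 (-(1 + i)) (by grind)]
      refine mem_crossOrbital_of_crossRatio h9 hpow _ _ 1 0 (hz _ hm0) rfl ?_ ?_ ?_ ?_ ?_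
        <;> grind
  · refine ⟨mem_crossOrbital_self hne4, ?_, ?_, ?_, ?_⟩
    · refine mem_crossOrbital_of_crossRatio h9 hpow _ _ (1 + i) 1 (hz' _ one_ne_zero)
        (Finset.pair_comm _ _) ?_ ?_ ?_ ?_ ?_ <;> grind
    · change _ ∈ crossOrbital σ hσ (1 + i)
      rw [← m4 (-(1 + i)) (by grind)]
      refine mem_crossOrbital_of_crossRatio h9 hpow _ _ 1 (1 + i) (hz _ hi0) rfl ?_ ?_ ?_ ?_ ?_
        <;> grind
    · refine mem_crossOrbital_of_crossRatio h9 hpow _ _ 1 (1 + i) (hz' _ hp0) rfl ?_ ?_ ?_ ?_ ?_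
        <;> grind
    · change _ ∈ crossOrbital σ hσ (1 + i)
      rw [← m4 (1 - i) (by grind)]
      refine mem_crossOrbital_of_crossRatio h9 hpow _ _ 1 (1 + i) (hz _ hm0) rfl ?_ ?_ ?_ ?_ ?_
        <;> grind

theorem isPPolynomialScheme_of_card_eq_nine (h9 : Fintype.card F = 9)
    (hpow : ∀ x, σ x = x ^ 3) : IsPPolynomialScheme
      (orbitals (twistedGammaL σ hσ) (Set.powersetCard (OnePoint F) 2)) 4 := by
  classical
  obtain ⟨i, hi⟩ : IsSquare (-1 : F) :=
    isSquare_neg_one_of_odd_sqrt_card (r := 3) (by rw [h9]) (by decide)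
  replace hi := hi.symm
  let := Fintype.ofFinite (Set.powersetCard (OnePoint F) 2)
  have hbij := bijOn_nineOrbital (hσ := hσ) h9 hpow hi
  obtain ⟨z, hz⟩ := exists_oppositePair h9
  have hscheme : IsAssociationScheme
      (orbitals (twistedGammaL σ hσ) (Set.powersetCard (OnePoint F) 2)) 4 :=
    isAssociationScheme_orbitals_twistedGammaL (r := 3) (by rw [h9]) (by decide) hpow (by rw [h9])
  obtain ⟨⟨y₀, a₀, a₁, a₂, a₃, a₄⟩, ⟨y₁, b₀, b₁, b₂, b₃, b₄⟩, ⟨y₂, c₀, c₁, c₂, c₃, c₄⟩,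
    ⟨y₃, d₀, d₁, d₂, d₃, d₄⟩, ⟨y₄, e₀, e₁, e₂, e₃, e₄⟩⟩ :=
    exists_nineOrbital_representatives (hσ := hσ) h9 hpow hi hz
  -- In each row, k indexes the relation of (x, y) and the mᵢ index the relations to y of the four
  -- neighbours of x. Counting the mᵢ equal to j gives the entry of A₁Aⱼ.
  have key : ∀ x y, ∃ k m₁ m₂ m₃ m₄ : ℕ, (k, m₁, m₂, m₃, m₄) ∈
        [(0, 1, 1, 1, 1), (1, 0, 1, 2, 2), (2, 3, 3, 2, 1), (3, 3, 2, 4, 4), (4, 3, 4, 3, 4)] ∧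
      ∀ j ≤ 4, adjacencyMatrix (nineOrbital σ hσ i j) x y = (if j = k then 1 else 0) ∧
        (adjacencyMatrix (nineOrbital σ hσ i 1) * adjacencyMatrix (nineOrbital σ hσ i j)) x y =
        (if j = m₁ then 1 else 0) + (if j = m₂ then 1 else 0) + (if j = m₃ then 1 else 0) +
          (if j = m₄ then 1 else 0) := by
    intro x y
    obtain ⟨R, ⟨hR, hxy⟩, -⟩ := hscheme.isPartition.2 (x, y)
    obtain ⟨k, hk, rfl⟩ := hbij.surjOn hR
    have hk' : k ≤ 4 := hk
    have hadj := fun j hj =>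
      adjacencyMatrix_nineOrbital_apply (hσ := hσ) h9 hpow hi (j := j) hj hk' hxy
    interval_cases k
    · exact ⟨0, 1, 1, 1, 1, by simp, fun j hj => ⟨hadj j hj,
        mul_adjacencyMatrix_nineOrbital_eq h9 hpow hi hz
          (by simp) (by simp) (by simp) (by simp) (by simp) a₀ a₁ a₂ a₃ a₄ hxy hj⟩⟩
    · exact ⟨1, 0, 1, 2, 2, by simp, fun j hj => ⟨hadj j hj,
        mul_adjacencyMatrix_nineOrbital_eq h9 hpow hi hz
          (by simp) (by simp) (by simp) (by simp) (by simp) b₀ b₁ b₂ b₃ b₄ hxy hj⟩⟩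
    · exact ⟨2, 3, 3, 2, 1, by simp, fun j hj => ⟨hadj j hj,
        mul_adjacencyMatrix_nineOrbital_eq h9 hpow hi hz
          (by simp) (by simp) (by simp) (by simp) (by simp) c₀ c₁ c₂ c₃ c₄ hxy hj⟩⟩
    · exact ⟨3, 3, 2, 4, 4, by simp, fun j hj => ⟨hadj j hj,
        mul_adjacencyMatrix_nineOrbital_eq h9 hpow hi hz
          (by simp) (by simp) (by simp) (by simp) (by simp) d₀ d₁ d₂ d₃ d₄ hxy hj⟩⟩
    · exact ⟨4, 3, 4, 3, 4, by simp, fun j hj => ⟨hadj j hj,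
        mul_adjacencyMatrix_nineOrbital_eq h9 hpow hi hz
          (by simp) (by simp) (by simp) (by simp) (by simp) e₀ e₁ e₂ e₃ e₄ hxy hj⟩⟩
  refine isPPolynomialScheme_of_recurrence hscheme (isSymmetricFamily_of_card_eq_nine h9 hpow)
    (nineOrbital σ hσ i) hbij rfl ?_ ?_ ?_
  -- Each matrix identity is now arithmetic on the five rows.
  all_goals
    ext x y
    obtain ⟨k, m₁, m₂, m₃, m₄, hmem, hval⟩ := key x y
    simp only [Matrix.add_apply, Matrix.smul_apply, (hval 0 (by simp)).1, (hval 1 (by simp)).1,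
      (hval 2 (by simp)).1, (hval 3 (by simp)).1, (hval 4 (by simp)).1, (hval 1 (by simp)).2,
      (hval 2 (by simp)).2, (hval 3 (by simp)).2]
    simp only [List.mem_cons, List.not_mem_nil, or_false, Prod.mk.injEq] at hmem
    rcases hmem with ⟨rfl, rfl, rfl, rfl, rfl⟩ | ⟨rfl, rfl, rfl, rfl, rfl⟩ |
      ⟨rfl, rfl, rfl, rfl, rfl⟩ | ⟨rfl, rfl, rfl, rfl, rfl⟩ | ⟨rfl, rfl, rfl, rfl, rfl⟩ <;>
    norm_num

end PPolynomialNine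

theorem theoremt {F : Type*} [Field F] [Fintype F] [DecidableEq F]
    (p f : ℕ) (hp : p.Prime) (hp2 : p ≠ 2) (hf : 0 < f) (hq : Fintype.card F = p ^ (2 * f))
    (σ : RingAut F) (hσ : orderOf σ = 2) :
    (9 < Fintype.card F →
      (∃ d : ℕ, 8 * d = 3 * Fintype.card F + 5 ∧
        IsAssociationScheme (orbitals (rhoTwistedM σ hσ) (hyperbolicLines F)) d ∧
        ¬ IsSymmetricFamily (orbitals (rhoTwistedM σ hσ) (hyperbolicLines F))) ∧
      (∃ d : ℕ, 8 * d = 3 * Fintype.card F + 5 ∧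
        IsAssociationScheme (orbitals (twistedM σ hσ) (Set.powersetCard (OnePoint F) 2)) d ∧
        ¬ IsSymmetricFamily (orbitals (twistedM σ hσ) (Set.powersetCard (OnePoint F) 2)))) ∧
    (Fintype.card F = 9 →
      (∃ d : ℕ, IsPPolynomialScheme (orbitals (rhoTwistedM σ hσ) (hyperbolicLines F)) d) ∧
      (∃ d : ℕ, IsPPolynomialScheme
        (orbitals (twistedM σ hσ) (Set.powersetCard (OnePoint F) 2)) d)) := by
  obtain ⟨r, hr, hpow⟩ := exists_involution_eq_pow hp hq hσ
  have hodd : Odd r := by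
    have h1 : Odd (r * r) := by
      rw [hr, hq]
      exact (hp.odd_of_ne_two hp2).pow
    exact (Nat.odd_mul.1 h1).1
  obtain ⟨e, he⟩ := orbitals_rhoTwistedM (σ := σ) (hσ := hσ)
  rw [he, orbitals_twistedM]
  constructor
  · intro h9
    have h3 : 3 < r := by
      by_contra! h
      have := Nat.mul_le_mul h h
      omega
    -- Divisibility by 8 comes from the count itself: d is the number of orbitals minus the
    -- diagonal.
    obtain ⟨d, hd⟩ : ∃ d, 8 * d = 3 * Fintype.card F + 5 := by
      have h8 := eight_mul_ncard_orbitals (hσ := hσ) hr hodd hpow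
      exact ⟨(orbitals (twistedGammaL σ hσ) (Set.powersetCard (OnePoint F) 2)).ncard - 1, by omega⟩
    have hs := isAssociationScheme_orbitals_twistedGammaL (hσ := hσ) hr hodd hpow hd
    have hn := not_isSymmetricFamily_orbitals_twistedGammaL (hσ := hσ) hr hodd hpow h3
    exact ⟨⟨d, hd, hs.transport e, (isSymmetricFamily_transport_iff e).not.2 hn⟩, ⟨d, hd, hs, hn⟩⟩
  · intro h9
    have h3 : r = 3 := by
      have : r * r = 3 * 3 := by rw [hr, h9]
      exact Nat.mul_self_inj.1 this
    subst h3
    have h := isPPolynomialScheme_of_card_eq_nine (hσ := hσ) h9 hpow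
    exact ⟨⟨4, h.transport e⟩, ⟨4, h⟩⟩
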